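/- **Conventions.** On $\mathbb R^3$ write $x=(x_1,x_2,x_3)$, $\xi_{\rm h}=(\xi_1,\xi_2)$, and $\widehat u(\xi)=\int e^{-2\pi i x\cdot\xi}u(x)\,dx$, extended to tempered distributions. Norms take values in $[0,\infty]$; an $L^p$ norm is $+\infty$ if the distribution is not a function, and $0\cdot\infty=0$. For $s,s'\in\mathbb R$ let $$\|a\|_{H^{s,s'}}^2=\int_{\mathbb R^3}|\xi_{\rm h}|^{2s}|\xi_3|^{2s'}|\widehat a(\xi)|^2\,d\xi$$ ($+\infty$ if $\widehat a$ is not a locally integrable function), and for $\theta\in\,]0,1/2[$ let $\mathcal H_\theta=H^{-\frac12+\theta,-\theta}$ and $\|\nabla a\|_{\mathcal H_\theta}^2=\sum_{j=1}^3\|\partial_ja\|_{\mathcal H_\theta}^2$. Fix a smooth $\varphi:\mathbb R\to\mathbb R$ supported in $\{\tfrac34\le|\tau|\le\tfrac83\}$ with $\sum_{j\in\mathbb Z}\varphi(2^{-j}\tau)=1$ for all $\tau>0$, and let $\Delta^{\rm h}_k$, $\Delta^{\rm v}_\ell$ be the Fourier multipliers by $\varphi(2^{-k}|\xi_{\rm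 h}|)$ and $\varphi(2^{-\ell}|\xi_3|)$. Put $$\|u\|_{(B^{1}_{2,1})_{\rm h}(B^{s}_{2,1})_{\rm v}}=\sum_{k\in\mathbb Z}2^{k}\sum_{\ell\in\mathbb Z}2^{\ell s}\|\Delta^{\rm h}_k\Delta^{\rm v}_\ell u\|_{L^2},$$ the norm of a vector being the sum of the norms of its components. **Proposition 4.1.** Let $\alpha,\theta\in\,]0,1/2[$. There is a constant $C$, depending only on $\alpha$, $\theta$ (and $\varphi$), such that the following holds. Let $v=(v^{\rm h},v^3)=(v^1,v^2,v^3)$ be a divergence-free vector field on $\mathbb R^3$ whose components are tempered distributions and for which $\omega=\partial_1v^2-\partial_2v^1$ is a real-valued locally integrable function, and set $\omega_{\frac34}=\frac{\omega}{|\omega|}|\omega|^{\frac34}$ (equal to $0$ where $\omega=0$). Then $$\|v^{\rm h}\|_{(B^{1}_{2,1})_{\rm h}(B^{\frac12-\alpha}_{2,1})_{\rm v}}\le C\Bigl(\|\omega_{\frac34}\|_{L^2}^{\frac13+\alpha}\,\|\nabla\omega_{\frac34}\|_{L^2}^{1-\alpha}+\|\partial_3v^3\|_{\mathcal H_\theta}^{\alpha}\,\|\nabla\partial_3v^3\|_{\mathcal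 H_\theta}^{1-\alpha}\Bigr).$$ -/

import Mathlib

open MeasureTheory
open scoped ENNReal NNReal ContDiff SchwartzMap FourierTransform LineDeriv

noncomputable section

namespace AnisoBesov

/-- The physical (and frequency) space `ℝ³`; the coordinates `x₁, x₂, x₃` are `x 0, x 1, x 2`. -/
abbrev R3 : Type := EuclideanSpace ℝ (Fin 3)

/-- The `i`-th vector of the canonical basis of `ℝ³`. -/
def e (i : Fin 3) : R3 := EuclideanSpace.single i 1

/-- Length `|ξ_h|` of the horizontal part `ξ_h = (ξ₁, ξ₂)` of `ξ`. -/
def hnorm (ξ : R3) : ℝ := √(ξ 0 ^ 2 + ξ 1 ^ 2)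

/-! ### Functions and tempered distributions -/

/-- The tempered distribution `T` is (given by) the locally integrable function `f`.
Testing against compactly supported Schwartz functions determines `T`, and all the integrals
converge. -/
def IsGivenBy (T : 𝓢'(R3, ℂ)) (f : R3 → ℂ) : Prop :=
  LocallyIntegrable f volume ∧
    ∀ u : 𝓢(R3, ℂ), HasCompactSupport (⇑u) → T u = ∫ x, u x * f x

/-- The `L^p` norm of a tempered distribution, equal to `∞` if it is not a function
(the functions by which `T` is given agree almost everywhere, so that the infimum runs over one
single value, or over the empty set). -/
def lpNorm (p : ℝ≥0∞) (T : 𝓢'(R3, ℂ)) : ℝ≥0∞ :=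
  ⨅ (f : R3 → ℂ) (_ : IsGivenBy T f), eLpNorm f p volume

/-- `G` is the gradient, in the sense of distributions, of the function `b`, both being locally
integrable. -/
def IsWeakGradient (b : R3 → ℝ) (G : R3 → R3) : Prop :=
  LocallyIntegrable b volume ∧ LocallyIntegrable G volume ∧
    ∀ u : R3 → ℝ, ContDiff ℝ ∞ u → HasCompactSupport u →
      ∀ i : Fin 3, ∫ x, b x * fderiv ℝ u x (e i) = -∫ x, G x i * u x

/-- `‖∇b‖_{L^p}`, equal to `∞` if the distribution `∇b` is not a function. -/
def gradLpNorm (p : ℝ≥0∞) (b : R3 → ℝ) : ℝ≥0∞ :=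
  ⨅ (G : R3 → R3) (_ : IsWeakGradient b G), eLpNorm G p volume

/-- `a_α = (a / |a|) |a|^α`, with value `0` where `a = 0`. -/
def signedPow (α a : ℝ) : ℝ := a / |a| * |a| ^ α

/-! ### Anisotropic Sobolev norms -/

/-- The norm of `H^{s,s'}`: the square root of `∫ |ξ_h|^{2s} |ξ₃|^{2s'} |û(ξ)|² dξ`, equal to `∞`
if `û` is not a function. -/
def sobolevNorm (s s' : ℝ) (T : 𝓢'(R3, ℂ)) : ℝ≥0∞ :=
  ⨅ (f : R3 → ℂ) (_ : IsGivenBy (𝓕 T) f),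
    (∫⁻ ξ, ENNReal.ofReal (hnorm ξ) ^ (2 * s) * ENNReal.ofReal |ξ 2| ^ (2 * s') * ‖f ξ‖ₑ ^ 2)
      ^ (1 / 2 : ℝ)

/-- The norm of `𝓗_θ = H^{-1/2+θ,-θ}`. -/
def hThetaNorm (θ : ℝ) (T : 𝓢'(R3, ℂ)) : ℝ≥0∞ := sobolevNorm (-(1 / 2) + θ) (-θ) T

/-- `‖∇T‖_{𝓗_θ}`. -/
def gradHThetaNorm (θ : ℝ) (T : 𝓢'(R3, ℂ)) : ℝ≥0∞ :=
  (∑ j : Fin 3, hThetaNorm θ (∂_{e j} T) ^ 2) ^ (1 / 2 : ℝ)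

/-! ### Anisotropic Littlewood–Paley decomposition and Besov norms -/

/-- The functions `φ` used in dyadic decompositions: `φ` is smooth, supported in
`3/4 ≤ |τ| ≤ 8/3`, and `∑_{j ∈ ℤ} φ(2^{-j} τ) = 1` for `τ > 0`. -/
structure IsDyadicCutoff (φ : ℝ → ℝ) : Prop where
  smooth : ContDiff ℝ ∞ φ
  supp : tsupport φ ⊆ {τ : ℝ | 3 / 4 ≤ |τ| ∧ |τ| ≤ 8 / 3}
  hasSum : ∀ τ : ℝ, 0 < τ → HasSum (fun j : ℤ => φ ((2 : ℝ) ^ (-j) * τ)) 1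

/-- The horizontal block `Δ_k^h`: the Fourier multiplier by `φ(2^{-k} |ξ_h|)`. -/
def blockH (φ : ℝ → ℝ) (k : ℤ) (T : 𝓢'(R3, ℂ)) : 𝓢'(R3, ℂ) :=
  TemperedDistribution.fourierMultiplierCLM ℂ
    (fun ξ : R3 => ((φ ((2 : ℝ) ^ (-k) * hnorm ξ) : ℝ) : ℂ)) T

/-- The vertical block `Δ_ℓ^v`: the Fourier multiplier by `φ(2^{-ℓ} |ξ₃|)`. -/
def blockV (φ : ℝ → ℝ) (l : ℤ) (T : 𝓢'(R3, ℂ)) : 𝓢'(R3, ℂ) :=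
  TemperedDistribution.fourierMultiplierCLM ℂ
    (fun ξ : R3 => ((φ ((2 : ℝ) ^ (-l) * |ξ 2|) : ℝ) : ℂ)) T

/-- The norm of `(B^{s₁}_{p,q₁})_h (B^{s₂}_{p,q₂})_v` for finite `q₁, q₂`. -/
def besovNorm (φ : ℝ → ℝ) (p : ℝ≥0∞) (s₁ q₁ s₂ q₂ : ℝ) (T : 𝓢'(R3, ℂ)) : ℝ≥0∞ :=
  (∑' k : ℤ, (2 : ℝ≥0∞) ^ (q₁ * k * s₁) *
    (∑' l : ℤ, (2 : ℝ≥0∞) ^ (q₂ * l * s₂) * lpNorm p (blockH φ k (blockV φ l T)) ^ q₂)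
      ^ (q₁ / q₂)) ^ (1 / q₁)

/-! ### Vector fields -/

/-- `div v = ∂₁v¹ + ∂₂v² + ∂₃v³ = 0` in the sense of distributions. -/
def DivergenceFree (v : Fin 3 → 𝓢'(R3, ℂ)) : Prop := ∑ i : Fin 3, ∂_{e i} (v i) = 0

/-- The third component `∂₁v² - ∂₂v¹` of the vorticity of `v`. -/
def vorticity (v : Fin 3 → 𝓢'(R3, ℂ)) : 𝓢'(R3, ℂ) := ∂_{e 0} (v 1) - ∂_{e 1} (v 0)

end AnisoBesov

end

/-!
The proof works by duality, at the level of the action of distributions on Schwartz functions, so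
that neither convolution kernels nor a chain rule for Sobolev functions are needed.

A block `Δ_k^h Δ_l^v T` acts on a Schwartz function `u` as `T (op n u)`, where `n` is the symbol of
the block, smooth and supported in the shell `|ξ_h| ∼ 2^k`, `|ξ₃| ∼ 2^l`. Its `L²` norm is the best
constant in `|T (op n u)| ≤ D ‖u‖_{L²}` (`lpNorm_two_le`, by Riesz representation). Dividing the
symbol by `|ξ_h|²` gives the horizontal Biot–Savart law on the shell (`biotSavart_zero`,
`biotSavart_one`), which expresses a block of `v^h` as `2^{-k}` times blocks of `ω` and `∂₃v³`.
Dividing the symbol by `ξ₃` or by `|ξ_h|` shows that a bound `A` on `T` and a bound `B` on `∇T`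
combine into the bound `min (A, 2^{-k} B, 2^{-l} B)` (`HasScaleBound.gain`).

For `a = ∂₃v³` the bounds `A = ‖a‖_{𝓗_θ}` and `B = ‖∇a‖_{𝓗_θ}`, with the weight
`2^{k(1/2-θ) + lθ}`, come from the Cauchy–Schwarz inequality on the Fourier side
(`hasScaleBound_hThetaNorm`). For `ω`, with `b = ω_{3/4}`, they are
`A = ‖ω‖_{L^{3/2}} = ‖b‖_{L²}^{4/3}` and `B = 2 ‖b‖_{L²}^{1/3} ‖∇b‖_{L²}`, with the weight
`2^{k/3 + l/6}` of the Bernstein inequality from `L²` to `L³` on the dual side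
(`IsLocalized.eLpNorm_op_le`). The value of `B` is obtained from translations instead of
derivatives: `|ω' - ω| ≤ (|b'|^{1/3} + |b|^{1/3}) |b' - b|` pointwise, and the translates of `b` are
`‖∇b‖_{L²}`-Lipschitz in `L²` (`eLpNorm_sub_translate_le`, `IsGivenBy.enorm_lineDeriv_apply_le`).

It remains to sum `2^{kp + lq} min (A, 2^{-k} B, 2^{-l} B)` over `k` and `l`, with `p, q > 0` and
`p + q = 1 - α`; the result is a multiple of `A^α B^{1-α}` (`exists_tsum_gain_le`). All estimates
are stated in `[0, ∞]`, which takes care of infinite norms and of the convention `0 · ∞ = 0`.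
-/

open MeasureTheory
open scoped ENNReal NNReal ContDiff SchwartzMap FourierTransform LineDeriv

noncomputable section

namespace AnisoBesov

/-! ### Density of test functions in the Schwartz space -/

section Density

variable {E F : Type*} [NormedAddCommGroup E] [NormedSpace ℝ E] [FiniteDimensional ℝ E]
  [NormedAddCommGroup F] [NormedSpace ℝ F]

/-- A smooth cutoff which is `1` on the unit ball and all of whose derivatives are bounded. -/
theorem exists_smooth_truncation (E : Type*) [NormedAddCommGroup E] [NormedSpace ℝ E]
    [FiniteDimensional ℝ E] :
    ∃ χ : E → ℝ, ContDiff ℝ ∞ χ ∧ HasCompactSupport χ ∧ (∀ x, ‖x‖ ≤ 1 → χ x = 1) ∧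
      ∀ i : ℕ, ∃ C : ℝ, 0 ≤ C ∧ ∀ x, ‖iteratedFDeriv ℝ i χ x‖ ≤ C := by
  let f : ContDiffBump (0 : E) := ⟨1, 2, one_pos, one_lt_two⟩
  refine ⟨f, f.contDiff, f.hasCompactSupport, fun x hx => ?_, fun i => ?_⟩
  · exact f.one_of_mem_closedBall (by simpa using hx)
  · obtain ⟨C, hC⟩ := (f.hasCompactSupport.iteratedFDeriv i).exists_bound_of_continuous
      ((f.contDiff (n := (⊤ : ℕ∞))).continuous_iteratedFDeriv (m := i) (by exact_mod_cast le_top))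
    exact ⟨C, (norm_nonneg _).trans (hC 0), hC⟩

/-- Compactly supported functions are dense in the Schwartz space. -/
theorem dense_hasCompactSupport : Dense {u : 𝓢(E, F) | HasCompactSupport (⇑u)} := by
  obtain ⟨χ, hχ, hcs, hone, hbd⟩ := exists_smooth_truncation E
  choose C hC0 hC using hbd
  intro u
  -- The truncations `χ (c x) u` converge to `u`: the factor `1 - χ (c x)` vanishes for
  -- `|x| < 1 / c`, so one extra power of `|x|` in a seminorm gains a factor `c`.
  let c : ℕ → ℝ := fun n => ((n : ℝ) + 1)⁻¹
  have hc0 : ∀ n, 0 < c n := fun n => by positivity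
  have hc1 : ∀ n, c n ≤ 1 := fun n => inv_le_one_of_one_le₀ (by linarith [n.cast_nonneg (α := ℝ)])
  let χn : ℕ → E → ℝ := fun n x => χ (c n • x)
  have hχn : ∀ n, ContDiff ℝ ∞ (χn n) := fun n => hχ.comp (contDiff_const_smul (c n))
  have hcsn : ∀ n, HasCompactSupport (χn n) := fun n =>
    hcs.comp_homeomorph (Homeomorph.smulOfNeZero (c n) (hc0 n).ne')
  have htg : ∀ n, (χn n).HasTemperateGrowth := fun n => (hcsn n).hasTemperateGrowth (hχn n)
  refine mem_closure_of_tendsto (f := fun n : ℕ => SchwartzMap.smulLeftCLM F (χn n) u)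
    (b := Filter.atTop) ?_ (Filter.Eventually.of_forall fun n => ?_)
  swap
  · change HasCompactSupport _
    rw [SchwartzMap.smulLeftCLM_apply (htg n)]
    exact (hcsn n).smul_right
  rw [(schwartz_withSeminorms ℝ E F).tendsto_nhds]
  intro ⟨k, m⟩ ε hε
  set K : ℝ := ∑ i ∈ Finset.range (m + 1), (m.choose i : ℝ) * (1 + C i) *
    SchwartzMap.seminorm ℝ (k + 1) (m - i) u with hK
  have hK0 : 0 ≤ K := Finset.sum_nonneg fun i _ => by have := hC0 i; positivity
  have key : ∀ n,
      SchwartzMap.seminorm ℝ k m (SchwartzMap.smulLeftCLM F (χn n) u - u) ≤ c n * K := by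
    intro n
    refine SchwartzMap.seminorm_le_bound ℝ k m _ (mul_nonneg (hc0 n).le hK0) fun x => ?_
    have hfun : ⇑(SchwartzMap.smulLeftCLM F (χn n) u - u) = fun x => (χn n x - 1) • u x := by
      ext y
      simp [SchwartzMap.smulLeftCLM_apply (htg n), sub_smul]
    rw [hfun]
    by_cases hx : c n * ‖x‖ < 1
    · have hloc : (fun x => (χn n x - 1) • u x) =ᶠ[nhds x] fun _ => 0 := by
        have : ∀ᶠ y in nhds x, c n * ‖y‖ < 1 :=
          (continuous_const.mul continuous_norm).continuousAt.eventually_lt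
            continuousAt_const hx
        filter_upwards [this] with y hy
        have : χn n y = 1 := hone _ (by rw [norm_smul, Real.norm_of_nonneg (hc0 n).le]; exact hy.le)
        simp [this]
      rw [hloc.iteratedFDeriv ℝ m |>.eq_of_nhds]
      have : iteratedFDeriv ℝ m (fun _ : E => (0 : F)) x = 0 := by
        rw [iteratedFDeriv_fun_zero]; rfl
      rw [this, norm_zero, mul_zero]
      exact mul_nonneg (hc0 n).le hK0
    · push Not at hx
      have hs : ContDiff ℝ ∞ (fun x => χn n x - 1) := (hχn n).sub contDiff_const
      have h1 := norm_iteratedFDeriv_smul_le (n := m) hs (u.smooth ⊤) x (by exact_mod_cast le_top)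
      have hder : ∀ i, ‖iteratedFDeriv ℝ i (fun x => χn n x - 1) x‖ ≤ 1 + C i := by
        intro i
        have e1 : iteratedFDeriv ℝ i (fun x => χn n x - 1) x =
            iteratedFDeriv ℝ i (χn n) x - iteratedFDeriv ℝ i (fun _ : E => (1 : ℝ)) x :=
          iteratedFDeriv_sub_apply ((hχn n).contDiffAt.of_le (by exact_mod_cast le_top))
            contDiffAt_const
        have e2 : ‖iteratedFDeriv ℝ i (fun _ : E => (1 : ℝ)) x‖ ≤ 1 := by
          rcases i with _ | i
          · simp
          · rw [iteratedFDeriv_const_of_ne (by simp)]; simp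
        have e3 : ‖iteratedFDeriv ℝ i (χn n) x‖ ≤ C i := by
          have := iteratedFDeriv_comp_const_smul (i := i) (c n)
            (hχ.of_le (by exact_mod_cast le_top))
          change ‖iteratedFDeriv ℝ i (fun x => χ (c n • x)) x‖ ≤ C i
          rw [this]
          simp only [norm_smul, norm_pow, Real.norm_of_nonneg (hc0 n).le]
          calc c n ^ i * ‖iteratedFDeriv ℝ i χ (c n • x)‖ ≤ 1 * C i :=
                mul_le_mul (pow_le_one₀ (hc0 n).le (hc1 n)) (hC i _) (norm_nonneg _) zero_le_one
            _ = C i := one_mul _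
        rw [e1]
        linarith [norm_sub_le (iteratedFDeriv ℝ i (χn n) x)
          (iteratedFDeriv ℝ i (fun _ : E => (1 : ℝ)) x)]
      calc ‖x‖ ^ k * ‖iteratedFDeriv ℝ m (fun x => (χn n x - 1) • u x) x‖
          ≤ (c n * ‖x‖) * ‖x‖ ^ k * ∑ i ∈ Finset.range (m + 1), (m.choose i : ℝ) *
              ‖iteratedFDeriv ℝ i (fun x => χn n x - 1) x‖ * ‖iteratedFDeriv ℝ (m - i) u x‖ := by
            refine mul_le_mul ?_ h1 (norm_nonneg _) (by have := hc0 n; positivity)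
            exact le_mul_of_one_le_left (by positivity) hx
        _ = c n * ∑ i ∈ Finset.range (m + 1), (m.choose i : ℝ) *
              ‖iteratedFDeriv ℝ i (fun x => χn n x - 1) x‖ *
              (‖x‖ ^ (k + 1) * ‖iteratedFDeriv ℝ (m - i) u x‖) := by
            rw [Finset.mul_sum, Finset.mul_sum]
            exact Finset.sum_congr rfl fun i _ => by ring
        _ ≤ c n * K := by
            refine mul_le_mul_of_nonneg_left (Finset.sum_le_sum fun i _ => ?_) (hc0 n).le
            have := hC0 i
            refine mul_le_mul (mul_le_mul_of_nonneg_left (hder i) (by positivity))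
              (SchwartzMap.le_seminorm ℝ _ _ u x) (by positivity) (by positivity)
  have hlim : Filter.Tendsto (fun n : ℕ => c n * K) Filter.atTop (nhds 0) := by
    have h := (tendsto_one_div_add_atTop_nhds_zero_nat (𝕜 := ℝ)).mul_const K
    simpa [c, one_div] using h
  filter_upwards [hlim.eventually_lt_const hε] with n hn
  exact (key n).trans_lt hn

end Density

/-! ### Duality in `L²` -/

/-- The space of compactly supported Schwartz functions. -/
def testSubmodule : Submodule ℂ 𝓢(R3, ℂ) where
  carrier := {u | HasCompactSupport (⇑u)}
  add_mem' {u v} hu hv := by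
    have : ⇑(u + v) = ⇑u + ⇑v := rfl
    simpa [this] using HasCompactSupport.add hu hv
  zero_mem' := by
    have : ⇑(0 : 𝓢(R3, ℂ)) = 0 := rfl
    simpa [this] using HasCompactSupport.zero
  smul_mem' c u hu := by
    have : ⇑(c • u) = fun x => c • u x := rfl
    rw [Set.mem_ofPred_eq, this]
    exact HasCompactSupport.smul_left (f := fun _ => c) hu

/-- Test functions are dense in `L²`. -/
theorem denseRange_testSubmodule_toLp :
    DenseRange (((SchwartzMap.toLpCLM ℂ ℂ 2 (volume : Measure R3)).toLinearMap).comp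
      testSubmodule.subtype) := by
  have h : (Set.range (((SchwartzMap.toLpCLM ℂ ℂ 2 (volume : Measure R3)).toLinearMap).comp
      testSubmodule.subtype)) =
      (SchwartzMap.toLpCLM ℂ ℂ 2 (volume : Measure R3)) '' {u | HasCompactSupport (⇑u)} := by
    ext f
    constructor
    · rintro ⟨u, rfl⟩; exact ⟨u.1, u.2, rfl⟩
    · rintro ⟨u, hu, rfl⟩; exact ⟨⟨u, hu⟩, rfl⟩
  rw [DenseRange, h]
  exact (SchwartzMap.denseRange_toLpCLM (by simp)).dense_image
    (SchwartzMap.toLpCLM ℂ ℂ 2 (volume : Measure R3)).continuous dense_hasCompactSupport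

theorem locallyIntegrable_ofReal {f : R3 → ℝ} (hf : LocallyIntegrable f volume) :
    LocallyIntegrable (fun x => (f x : ℂ)) volume := fun x => by
  obtain ⟨s, hs, hi⟩ := hf x
  exact ⟨s, hs, hi.ofReal⟩

/-- Riesz representation: a linear functional on test functions bounded for the `L²` norm is the
integral against an `L²` function. -/
theorem exists_memLp_two_of_bound (ℓ : testSubmodule →ₗ[ℂ] ℂ) (D : ℝ≥0)
    (h : ∀ u : testSubmodule, ‖ℓ u‖ₑ ≤ D * eLpNorm (⇑u.1) 2 volume) :
    ∃ f : R3 → ℂ, MemLp f 2 volume ∧ eLpNorm f 2 volume ≤ D ∧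
      ∀ u : testSubmodule, ℓ u = ∫ x, u.1 x * f x := by
  set ι := ((SchwartzMap.toLpCLM ℂ ℂ 2 (volume : Measure R3)).toLinearMap).comp
      testSubmodule.subtype with hι
  have hnorm : ∀ u, ‖ℓ u‖ ≤ (D : ℝ) * ‖ι u‖ := by
    intro u
    have h1 : ‖ι u‖ = (eLpNorm (⇑u.1) 2 volume).toReal := SchwartzMap.norm_toLp
    have hfin := (u.1.memLp 2 (volume : Measure R3)).eLpNorm_ne_top
    have := ENNReal.toReal_mono (by finiteness) (h u)
    simpa [h1] using this
  let L := ℓ.extendOfNorm ι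
  have hL : ∀ u, L (ι u) = ℓ u :=
    LinearMap.extendOfNorm_eq denseRange_testSubmodule_toLp ⟨D, hnorm⟩
  have hLn : ‖L‖ ≤ D := ContinuousLinearMap.opNorm_le_bound _ D.2
    (LinearMap.norm_extendOfNorm_apply_le denseRange_testSubmodule_toLp D hnorm)
  let g := (InnerProductSpace.toDual ℂ (Lp ℂ 2 (volume : Measure R3))).symm L
  have hg : ‖g‖ ≤ D := by simpa [g] using hLn
  have hmem : MemLp (fun x => starRingEnd ℂ (g x)) 2 volume := (Lp.memLp g).star
  refine ⟨fun x => starRingEnd ℂ (g x), hmem, ?_, fun u => ?_⟩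
  · have h1 : eLpNorm (fun x => starRingEnd ℂ (g x)) 2 volume = eLpNorm g 2 volume :=
      eLpNorm_congr_norm_ae (by simp)
    rw [h1, ← ENNReal.ofReal_toReal (Lp.eLpNorm_ne_top g), ← Lp.norm_def]
    exact (ENNReal.ofReal_le_ofReal hg).trans (by simp)
  · have h1 : inner ℂ g (ι u) = L (ι u) := InnerProductSpace.toDual_symm_apply
    rw [← hL, ← h1, L2.inner_def]
    refine integral_congr_ae ?_
    have h2 : (ι u : R3 → ℂ) =ᵐ[volume] ⇑u.1 := SchwartzMap.coeFn_toLp _ _ _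
    filter_upwards [h2] with x hx
    rw [hx]
    simp

/-- If a tempered distribution is bounded on test functions for the `L²` norm, its `L²` norm obeys
the same bound. -/
theorem lpNorm_two_le (S : 𝓢'(R3, ℂ)) (D : ℝ≥0∞)
    (h : ∀ u : 𝓢(R3, ℂ), ‖S u‖ₑ ≤ D * eLpNorm (⇑u) 2 volume) : lpNorm 2 S ≤ D := by
  by_cases hD : D = ⊤
  · simp [hD]
  lift D to ℝ≥0 using hD
  obtain ⟨f, hf, hfn, hfe⟩ := exists_memLp_two_of_bound
    ((S : 𝓢(R3, ℂ) →ₗ[ℂ] ℂ).comp testSubmodule.subtype) D (fun u => h u.1)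
  exact (iInf₂_le f ⟨hf.locallyIntegrable (by norm_num), fun u hu => hfe ⟨u, hu⟩⟩).trans hfn

/-- The `L²` norm of a locally integrable function is computed by duality with test functions. -/
theorem eLpNorm_two_le_of_duality (f : R3 → ℝ) (hf : LocallyIntegrable f volume) (D : ℝ≥0)
    (h : ∀ u : 𝓢(R3, ℂ), HasCompactSupport (⇑u) →
      ‖∫ x, u x * (f x : ℂ)‖ₑ ≤ D * eLpNorm (⇑u) 2 volume) :
    eLpNorm f 2 volume ≤ D := by
  have hfc : LocallyIntegrable (fun x => (f x : ℂ)) volume :=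
    locallyIntegrable_ofReal hf
  have hint : ∀ (u : 𝓢(R3, ℂ)), HasCompactSupport (⇑u) → Integrable (fun x => u x * (f x : ℂ)) :=
    fun u hu => hfc.integrable_smul_left_of_hasCompactSupport u.continuous hu
  let ℓ : testSubmodule →ₗ[ℂ] ℂ :=
    { toFun := fun u => ∫ x, u.1 x * (f x : ℂ)
      map_add' := fun u v => by
        rw [← integral_add (hint _ u.2) (hint _ v.2)]
        exact integral_congr_ae (.of_forall fun x => by simp [add_mul])
      map_smul' := fun c u => by
        simp only [RingHom.id_apply, smul_eq_mul]
        rw [← integral_const_mul]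
        exact integral_congr_ae (.of_forall fun x => by simp [mul_assoc]) }
  obtain ⟨g, hg, hgn, hge⟩ := exists_memLp_two_of_bound ℓ D (fun u => h u.1 u.2)
  have hgl : LocallyIntegrable g volume := hg.locallyIntegrable (by norm_num)
  have hae : (fun x => (f x : ℂ)) =ᵐ[volume] g := by
    refine ae_eq_of_integral_contDiff_smul_eq hfc hgl fun v hv hcs => ?_
    have hcs' : HasCompactSupport (fun x => (v x : ℂ)) := hcs.comp_left (g := Complex.ofReal) rfl
    have hv' : ContDiff ℝ ∞ (fun x => (v x : ℂ)) := Complex.ofRealCLM.contDiff.comp hv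
    have := hge ⟨hcs'.toSchwartzMap hv', hcs'⟩
    simpa [ℓ, Complex.real_smul] using this
  have h1 : eLpNorm f 2 volume = eLpNorm g 2 volume := by
    rw [← eLpNorm_congr_ae hae]
    exact eLpNorm_congr_norm_ae (by simp)
  exact h1 ▸ hgn

/-! ### Localized Fourier multipliers -/

/-- The product of annuli `|ξ_h| ∼ 2^k`, `|ξ₃| ∼ 2^l`. -/
def shell (k l : ℤ) : Set R3 :=
  {ξ | (3 / 4 * (2 : ℝ) ^ k ≤ hnorm ξ ∧ hnorm ξ ≤ 8 / 3 * (2 : ℝ) ^ k) ∧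
    3 / 4 * (2 : ℝ) ^ l ≤ |ξ 2| ∧ |ξ 2| ≤ 8 / 3 * (2 : ℝ) ^ l}

/-- `n` is a smooth symbol, bounded by `M` and vanishing off `shell k l`. -/
structure IsLocalized (k l : ℤ) (M : ℝ≥0) (n : R3 → ℂ) : Prop where
  smooth : ContDiff ℝ ∞ n
  bound : ∀ ξ, ‖n ξ‖ ≤ M
  supp : ∀ ξ, n ξ ≠ 0 → ξ ∈ shell k l

/-- The Fourier multiplier with symbol `n` acting on Schwartz functions, in the form in which it
arises by transposing a Fourier multiplier acting on tempered distributions. -/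
def op (n : R3 → ℂ) (u : 𝓢(R3, ℂ)) : 𝓢(R3, ℂ) := 𝓕 (SchwartzMap.smulLeftCLM ℂ n (𝓕⁻ u))

theorem continuous_hnorm : Continuous hnorm := by
  unfold hnorm
  fun_prop

theorem hnorm_sq (ξ : R3) : hnorm ξ ^ 2 = ξ 0 ^ 2 + ξ 1 ^ 2 := Real.sq_sqrt (by positivity)

theorem hnorm_nonneg (ξ : R3) : 0 ≤ hnorm ξ := Real.sqrt_nonneg _

theorem abs_zero_le_hnorm (ξ : R3) : |ξ 0| ≤ hnorm ξ :=
  Real.abs_le_sqrt (by nlinarith [sq_nonneg (ξ 1)])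

theorem abs_one_le_hnorm (ξ : R3) : |ξ 1| ≤ hnorm ξ :=
  Real.abs_le_sqrt (by nlinarith [sq_nonneg (ξ 0)])

theorem isClosed_shell (k l : ℤ) : IsClosed (shell k l) := by
  have h1 := continuous_hnorm
  have h2 : Continuous fun ξ : R3 => |ξ 2| := by fun_prop
  exact ((isClosed_le continuous_const h1).inter (isClosed_le h1 continuous_const)).inter
    ((isClosed_le continuous_const h2).inter (isClosed_le h2 continuous_const))

theorem hnorm_pos_of_mem_shell {k l : ℤ} {ξ : R3} (h : ξ ∈ shell k l) : 0 < hnorm ξ :=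
  lt_of_lt_of_le (by positivity) h.1.1

theorem abs_pos_of_mem_shell {k l : ℤ} {ξ : R3} (h : ξ ∈ shell k l) : 0 < |ξ 2| :=
  lt_of_lt_of_le (by positivity) h.2.1

theorem norm_le_of_mem_shell {k l : ℤ} {ξ : R3} (h : ξ ∈ shell k l) :
    ‖ξ‖ ≤ 8 / 3 * (2 : ℝ) ^ k + 8 / 3 * (2 : ℝ) ^ l := by
  rw [EuclideanSpace.norm_eq, Real.sqrt_le_left (by positivity)]
  simp only [Fin.sum_univ_three, Real.norm_eq_abs, sq_abs]
  have h1 : ξ 0 ^ 2 + ξ 1 ^ 2 ≤ (8 / 3 * (2 : ℝ) ^ k) ^ 2 :=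
    hnorm_sq ξ ▸ pow_le_pow_left₀ (hnorm_nonneg ξ) h.1.2 2
  have h2 : ξ 2 ^ 2 ≤ (8 / 3 * (2 : ℝ) ^ l) ^ 2 :=
    sq_abs (ξ 2) ▸ pow_le_pow_left₀ (abs_nonneg _) h.2.2 2
  have h3 : (0 : ℝ) < 8 / 3 * (2 : ℝ) ^ k := by positivity
  have h4 : (0 : ℝ) < 8 / 3 * (2 : ℝ) ^ l := by positivity
  nlinarith [mul_pos h3 h4]

namespace IsLocalized

variable {k l : ℤ} {M : ℝ≥0} {n : R3 → ℂ}

theorem hasCompactSupport (hn : IsLocalized k l M n) : HasCompactSupport n :=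
  HasCompactSupport.intro
    (isCompact_closedBall (0 : R3) (8 / 3 * (2 : ℝ) ^ k + 8 / 3 * (2 : ℝ) ^ l)) fun ξ hξ => by
      by_contra h
      exact hξ (by simpa using norm_le_of_mem_shell (hn.supp ξ h))

theorem hasTemperateGrowth (hn : IsLocalized k l M n) : n.HasTemperateGrowth :=
  hn.hasCompactSupport.hasTemperateGrowth hn.smooth

theorem op_eq (hn : IsLocalized k l M n) (u : 𝓢(R3, ℂ)) (ξ : R3) :
    (SchwartzMap.smulLeftCLM ℂ n (𝓕⁻ u)) ξ = n ξ * (𝓕⁻ u) ξ := by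
  rw [SchwartzMap.smulLeftCLM_apply_apply hn.hasTemperateGrowth, smul_eq_mul]

/-- A localized symbol may be multiplied by a function which is smooth near the shell. -/
theorem mul_left (hn : IsLocalized k l M n) {g : R3 → ℝ} {K : ℝ≥0}
    (hg : ∀ ξ ∈ shell k l, ContDiffAt ℝ ∞ g ξ) (hK : ∀ ξ ∈ shell k l, |g ξ| ≤ K) :
    IsLocalized k l (K * M) fun ξ => (g ξ : ℂ) * n ξ where
  smooth := contDiff_iff_contDiffAt.2 fun ξ => by
    by_cases hξ : ξ ∈ shell k l
    · exact (Complex.ofRealCLM.contDiff.contDiffAt.comp ξ (hg ξ hξ)).mul hn.smooth.contDiffAt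
    · refine (contDiffAt_const (c := (0 : ℂ))).congr_of_eventuallyEq ?_
      filter_upwards [(isClosed_shell k l).isOpen_compl.mem_nhds hξ] with ζ hζ
      have : n ζ = 0 := by_contra fun h => hζ (hn.supp ζ h)
      simp [this]
  bound ξ := by
    by_cases hξ : ξ ∈ shell k l
    · rw [norm_mul, Complex.norm_real, Real.norm_eq_abs, NNReal.coe_mul]
      exact mul_le_mul (hK ξ hξ) (hn.bound ξ) (norm_nonneg _) K.2
    · have : n ξ = 0 := by_contra fun h => hξ (hn.supp ξ h)
      simp only [this, mul_zero, norm_zero]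
      positivity
  supp ξ h := hn.supp ξ (right_ne_zero_of_mul h)

end IsLocalized

/-! ### Derivatives and division of symbols -/

theorem inner_e (ξ : R3) (j : Fin 3) : inner ℝ ξ (e j) = ξ j := by
  simp [e, EuclideanSpace.inner_single_right]

theorem IsLocalized.hasTemperateGrowth_coord_mul {k l : ℤ} {M : ℝ≥0} {n : R3 → ℂ}
    (hn : IsLocalized k l M n) (j : Fin 3) :
    Function.HasTemperateGrowth fun ξ : R3 => (ξ j : ℂ) * n ξ := by
  have h1 : Function.HasTemperateGrowth fun ξ : R3 => ((inner ℝ ξ (e j) : ℝ) : ℂ) := by fun_prop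
  simp only [inner_e] at h1
  exact h1.mul hn.hasTemperateGrowth

/-- A factor `ξ_j` in the symbol is a derivative. -/
theorem apply_op_coord_mul {k l : ℤ} {M : ℝ≥0} {n : R3 → ℂ} (hn : IsLocalized k l M n)
    (T : 𝓢'(R3, ℂ)) (j : Fin 3) (u : 𝓢(R3, ℂ)) :
    T (op (fun ξ => (ξ j : ℂ) * n ξ) u) =
      (2 * Real.pi * Complex.I)⁻¹ * (∂_{e j} T) (op n u) := by
  have hI : (2 * Real.pi * Complex.I : ℂ) ≠ 0 := by simp [Real.pi_ne_zero]
  have hj : Function.HasTemperateGrowth fun ξ : R3 => (inner ℝ ξ (e j) : ℝ) := by fun_prop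
  have hj' := hn.hasTemperateGrowth_coord_mul j
  have key : SchwartzMap.smulLeftCLM ℂ (fun ξ : R3 => (ξ j : ℂ) * n ξ) (𝓕⁻ u) =
      SchwartzMap.smulLeftCLM ℂ (inner ℝ · (e j)) (SchwartzMap.smulLeftCLM ℂ n (𝓕⁻ u)) := by
    ext ξ
    rw [SchwartzMap.smulLeftCLM_apply_apply hj', SchwartzMap.smulLeftCLM_apply_apply hj,
      hn.op_eq, inner_e]
    simp [mul_assoc]
  have h2 : -∂_{e j} (op n u) =
      (2 * Real.pi * Complex.I : ℂ) • op (fun ξ => (ξ j : ℂ) * n ξ) u := by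
    rw [op, SchwartzMap.lineDerivOp_fourier_eq, op, key, ← FourierTransform.fourier_smul, neg_smul,
      ← FourierTransform.fourier_neg, neg_neg]
  rw [TemperedDistribution.lineDerivOp_apply_apply, h2, map_smul, smul_eq_mul,
    inv_mul_cancel_left₀ hI]

theorem op_add {n₁ n₂ : R3 → ℂ} (h₁ : n₁.HasTemperateGrowth) (h₂ : n₂.HasTemperateGrowth)
    (u : 𝓢(R3, ℂ)) : op (fun ξ => n₁ ξ + n₂ ξ) u = op n₁ u + op n₂ u := by
  have := SchwartzMap.smulLeftCLM_add (F := ℂ) h₁ h₂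
  rw [op, op, op, ← FourierTransform.fourier_add]
  congr 1
  exact DFunLike.congr_fun this (𝓕⁻ u)

/-- `n / ξ₃`. -/
def divV (n : R3 → ℂ) (ξ : R3) : ℂ := (((ξ 2)⁻¹ : ℝ) : ℂ) * n ξ

/-- `ξ_i n / |ξ_h|²`. -/
def divH (i : Fin 3) (n : R3 → ℂ) (ξ : R3) : ℂ :=
  ((ξ i / (ξ 0 ^ 2 + ξ 1 ^ 2) : ℝ) : ℂ) * n ξ

namespace IsLocalized

variable {k l : ℤ} {M : ℝ≥0} {n : R3 → ℂ}

theorem divV (hn : IsLocalized k l M n) :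
    IsLocalized k l (4 / 3 * 2 ^ (-l) * M) (divV n) := by
  refine hn.mul_left (g := fun ξ => (ξ 2)⁻¹) (fun ξ hξ => ?_) fun ξ hξ => ?_
  · have : ξ 2 ≠ 0 := abs_pos.1 (abs_pos_of_mem_shell hξ)
    exact ContDiffAt.inv (by fun_prop) this
  · rw [abs_inv]
    push_cast
    rw [inv_le_comm₀ (abs_pos_of_mem_shell hξ) (by positivity), zpow_neg, mul_inv, inv_inv]
    exact le_trans (by norm_num) hξ.2.1

theorem divH (hn : IsLocalized k l M n) {i : Fin 3} (hi : ∀ ξ : R3, |ξ i| ≤ hnorm ξ) :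
    IsLocalized k l (4 / 3 * 2 ^ (-k) * M) (divH i n) := by
  refine hn.mul_left (g := fun ξ => ξ i / (ξ 0 ^ 2 + ξ 1 ^ 2)) (fun ξ hξ => ?_) fun ξ hξ => ?_
  · have : ξ 0 ^ 2 + ξ 1 ^ 2 ≠ 0 := by
      rw [← hnorm_sq]; exact (pow_pos (hnorm_pos_of_mem_shell hξ) 2).ne'
    exact ContDiffAt.div (by fun_prop) (by fun_prop) this
  · have h0 := hnorm_pos_of_mem_shell hξ
    rw [← hnorm_sq, abs_div, abs_of_nonneg (sq_nonneg (hnorm ξ))]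
    calc |ξ i| / hnorm ξ ^ 2 ≤ hnorm ξ / hnorm ξ ^ 2 := by gcongr; exact hi ξ
      _ = (hnorm ξ)⁻¹ := by field_simp
      _ ≤ _ := by
        push_cast
        rw [inv_le_comm₀ h0 (by positivity), zpow_neg, mul_inv, inv_inv]
        exact le_trans (by norm_num) hξ.1.1

theorem eq_mul_divV (hn : IsLocalized k l M n) :
    n = fun ξ => (ξ 2 : ℂ) * AnisoBesov.divV n ξ := by
  ext ξ
  by_cases h : n ξ = 0
  · simp [AnisoBesov.divV, h]
  · have : (ξ 2 : ℂ) ≠ 0 := by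
      exact_mod_cast abs_pos.1 (abs_pos_of_mem_shell (hn.supp ξ h))
    simp [AnisoBesov.divV, this]

theorem eq_add_divH (hn : IsLocalized k l M n) :
    n = fun ξ => (ξ 0 : ℂ) * AnisoBesov.divH 0 n ξ + (ξ 1 : ℂ) * AnisoBesov.divH 1 n ξ := by
  ext ξ
  by_cases h : n ξ = 0
  · simp [AnisoBesov.divH, h]
  · have h1 : ξ 0 ^ 2 + ξ 1 ^ 2 ≠ 0 := by
      rw [← hnorm_sq]; exact (pow_pos (hnorm_pos_of_mem_shell (hn.supp ξ h)) 2).ne'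
    have h2 : ((ξ 0 ^ 2 + ξ 1 ^ 2 : ℝ) : ℂ) ≠ 0 := Complex.ofReal_ne_zero.2 h1
    push_cast at h2
    simp only [AnisoBesov.divH]
    push_cast
    field_simp

end IsLocalized

theorem apply_op_eq_divV {k l : ℤ} {M : ℝ≥0} {n : R3 → ℂ} (hn : IsLocalized k l M n)
    (T : 𝓢'(R3, ℂ)) (u : 𝓢(R3, ℂ)) :
    T (op n u) = (2 * Real.pi * Complex.I)⁻¹ * (∂_{e 2} T) (op (divV n) u) := by
  rw [← apply_op_coord_mul hn.divV, ← hn.eq_mul_divV]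

theorem apply_op_eq_divH {k l : ℤ} {M : ℝ≥0} {n : R3 → ℂ} (hn : IsLocalized k l M n)
    (T : 𝓢'(R3, ℂ)) (u : 𝓢(R3, ℂ)) :
    T (op n u) = (2 * Real.pi * Complex.I)⁻¹ * (∂_{e 0} T) (op (divH 0 n) u) +
      (2 * Real.pi * Complex.I)⁻¹ * (∂_{e 1} T) (op (divH 1 n) u) := by
  have h0 := hn.divH abs_zero_le_hnorm
  have h1 := hn.divH abs_one_le_hnorm
  rw [← apply_op_coord_mul h0, ← apply_op_coord_mul h1, ← map_add,
    ← op_add (h0.hasTemperateGrowth_coord_mul 0) (h1.hasTemperateGrowth_coord_mul 1),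
    ← hn.eq_add_divH]

theorem coord_mul_divH_comm (n : R3 → ℂ) :
    (fun ξ : R3 => (ξ 1 : ℂ) * divH 0 n ξ) = fun ξ : R3 => (ξ 0 : ℂ) * divH 1 n ξ := by
  ext ξ
  simp only [divH]
  push_cast
  ring

/-- Both mixed terms `∂₂ (divH 0 n)` and `∂₁ (divH 1 n)` have the symbol `ξ₁ ξ₂ n / |ξ_h|²`. -/
theorem lineDeriv_divH_comm {k l : ℤ} {M : ℝ≥0} {n : R3 → ℂ} (hn : IsLocalized k l M n)
    (T : 𝓢'(R3, ℂ)) (u : 𝓢(R3, ℂ)) :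
    (2 * Real.pi * Complex.I)⁻¹ * (∂_{e 1} T) (op (divH 0 n) u) =
      (2 * Real.pi * Complex.I)⁻¹ * (∂_{e 0} T) (op (divH 1 n) u) := by
  rw [← apply_op_coord_mul (hn.divH abs_zero_le_hnorm),
    ← apply_op_coord_mul (hn.divH abs_one_le_hnorm), coord_mul_divH_comm]

theorem DivergenceFree.apply {v : Fin 3 → 𝓢'(R3, ℂ)} (hv : DivergenceFree v) (g : 𝓢(R3, ℂ)) :
    (∂_{e 0} (v 0)) g + (∂_{e 1} (v 1)) g + (∂_{e 2} (v 2)) g = 0 := by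
  have := DFunLike.congr_fun hv g
  simpa [Fin.sum_univ_three] using this

theorem vorticity_apply (v : Fin 3 → 𝓢'(R3, ℂ)) (g : 𝓢(R3, ℂ)) :
    vorticity v g = (∂_{e 0} (v 1)) g - (∂_{e 1} (v 0)) g := rfl

/-- Horizontal Biot–Savart law for `v¹`. -/
theorem biotSavart_zero {k l : ℤ} {M : ℝ≥0} {n : R3 → ℂ} (hn : IsLocalized k l M n)
    {v : Fin 3 → 𝓢'(R3, ℂ)} (hv : DivergenceFree v) (u : 𝓢(R3, ℂ)) :
    v 0 (op n u) = -(2 * Real.pi * Complex.I)⁻¹ *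
      ((∂_{e 2} (v 2)) (op (divH 0 n) u) + vorticity v (op (divH 1 n) u)) := by
  rw [apply_op_eq_divH hn, vorticity_apply]
  linear_combination (2 * Real.pi * Complex.I : ℂ)⁻¹ * hv.apply (op (divH 0 n) u) -
    lineDeriv_divH_comm hn (v 1) u

/-- Horizontal Biot–Savart law for `v²`. -/
theorem biotSavart_one {k l : ℤ} {M : ℝ≥0} {n : R3 → ℂ} (hn : IsLocalized k l M n)
    {v : Fin 3 → 𝓢'(R3, ℂ)} (hv : DivergenceFree v) (u : 𝓢(R3, ℂ)) :
    v 1 (op n u) = -(2 * Real.pi * Complex.I)⁻¹ *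
      ((∂_{e 2} (v 2)) (op (divH 1 n) u) - vorticity v (op (divH 0 n) u)) := by
  rw [apply_op_eq_divH hn, vorticity_apply]
  linear_combination (2 * Real.pi * Complex.I : ℂ)⁻¹ * hv.apply (op (divH 1 n) u) +
    lineDeriv_divH_comm hn (v 0) u

/-! ### Dyadic blocks -/

/-- Radial dyadic cutoffs are smooth and compactly supported. -/
theorem IsDyadicCutoff.hasTemperateGrowth_norm {φ : ℝ → ℝ} (hφ : IsDyadicCutoff φ) {V : Type*}
    [NormedAddCommGroup V] [InnerProductSpace ℝ V] [FiniteDimensional ℝ V] {c : ℝ} (hc : 0 < c) :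
    Function.HasTemperateGrowth fun y : V => φ (c * ‖y‖) := by
  have hz : ∀ τ, φ τ ≠ 0 → 3 / 4 ≤ |τ| ∧ |τ| ≤ 8 / 3 := fun τ h => hφ.supp (subset_tsupport φ h)
  refine HasCompactSupport.hasTemperateGrowth ?_ ?_
  · refine HasCompactSupport.intro (isCompact_closedBall (0 : V) (8 / 3 / c)) fun y hy => ?_
    by_contra h
    refine hy ?_
    have := (hz _ h).2
    rw [abs_of_nonneg (by positivity)] at this
    rw [mem_closedBall_zero_iff, le_div_iff₀' hc]
    exact this
  · refine contDiff_iff_contDiffAt.2 fun y => ?_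
    by_cases hy : y = 0
    · refine (contDiffAt_const (c := (0 : ℝ))).congr_of_eventuallyEq ?_
      have : ∀ᶠ z in nhds y, c * ‖z‖ < 3 / 4 := by
        refine (continuous_const.mul continuous_norm).continuousAt.eventually_lt
          continuousAt_const ?_
        simp [hy]
      filter_upwards [this] with z hz'
      by_contra h
      have h1 := (hz _ h).1
      rw [abs_of_nonneg (by positivity)] at h1
      linarith
    · exact hφ.smooth.contDiffAt.comp y (contDiffAt_const.mul (contDiffAt_norm ℝ hy))

/-- The horizontal projection `ξ ↦ ξ_h`. -/
def projH : R3 →L[ℝ] EuclideanSpace ℝ (Fin 2) :=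
  ((EuclideanSpace.equiv (Fin 2) ℝ).symm : (Fin 2 → ℝ) →L[ℝ] EuclideanSpace ℝ (Fin 2)).comp
    (ContinuousLinearMap.pi ![EuclideanSpace.proj 0, EuclideanSpace.proj 1])

theorem norm_projH (ξ : R3) : ‖projH ξ‖ = hnorm ξ := by
  rw [EuclideanSpace.norm_eq, hnorm]
  simp [projH, Fin.sum_univ_two]

theorem IsDyadicCutoff.hasTemperateGrowth_hnorm {φ : ℝ → ℝ} (hφ : IsDyadicCutoff φ) (k : ℤ) :
    Function.HasTemperateGrowth
      fun ξ : R3 => ((φ ((2 : ℝ) ^ (-k) * hnorm ξ) : ℝ) : ℂ) := by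
  have h := hφ.hasTemperateGrowth_norm (V := EuclideanSpace ℝ (Fin 2)) (c := (2 : ℝ) ^ (-k))
    (by positivity)
  have h2 := Function.HasTemperateGrowth.comp Function.Complex.hasTemperateGrowth_ofReal
    (h.comp projH.hasTemperateGrowth)
  simpa only [Function.comp_def, norm_projH] using h2

theorem IsDyadicCutoff.hasTemperateGrowth_abs {φ : ℝ → ℝ} (hφ : IsDyadicCutoff φ) (l : ℤ) :
    Function.HasTemperateGrowth
      fun ξ : R3 => ((φ ((2 : ℝ) ^ (-l) * |ξ 2|) : ℝ) : ℂ) := by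
  have h := hφ.hasTemperateGrowth_norm (V := ℝ) (c := (2 : ℝ) ^ (-l)) (by positivity)
  exact Function.HasTemperateGrowth.comp Function.Complex.hasTemperateGrowth_ofReal
    (h.comp (EuclideanSpace.proj 2 : R3 →L[ℝ] ℝ).hasTemperateGrowth)

/-- The symbol of `Δ_k^h Δ_l^v`. -/
def blockSymbol (φ : ℝ → ℝ) (k l : ℤ) (ξ : R3) : ℂ :=
  ((φ ((2 : ℝ) ^ (-l) * |ξ 2|) : ℝ) : ℂ) * ((φ ((2 : ℝ) ^ (-k) * hnorm ξ) : ℝ) : ℂ)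

theorem IsDyadicCutoff.block_apply {φ : ℝ → ℝ} (hφ : IsDyadicCutoff φ) (k l : ℤ)
    (T : 𝓢'(R3, ℂ)) (u : 𝓢(R3, ℂ)) :
    blockH φ k (blockV φ l T) u = T (op (blockSymbol φ k l) u) := by
  rw [blockH, blockV, TemperedDistribution.fourierMultiplierCLM_fourierMultiplierCLM_apply
    (hφ.hasTemperateGrowth_abs l) (hφ.hasTemperateGrowth_hnorm k),
    TemperedDistribution.fourierMultiplierCLM_apply_apply]
  rfl

theorem dyadic_bounds {x : ℝ} (hx : 0 ≤ x) {k : ℤ}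
    (h : 3 / 4 ≤ |(2 : ℝ) ^ (-k) * x| ∧ |(2 : ℝ) ^ (-k) * x| ≤ 8 / 3) :
    3 / 4 * (2 : ℝ) ^ k ≤ x ∧ x ≤ 8 / 3 * (2 : ℝ) ^ k := by
  have hp : (0 : ℝ) < 2 ^ k := by positivity
  rw [abs_of_nonneg (by positivity), zpow_neg, inv_mul_eq_div] at h
  exact ⟨(le_div_iff₀ hp).1 h.1, (div_le_iff₀ hp).1 h.2⟩

theorem IsDyadicCutoff.isLocalized_blockSymbol {φ : ℝ → ℝ} (hφ : IsDyadicCutoff φ) :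
    ∃ M : ℝ≥0, ∀ k l, IsLocalized k l M (blockSymbol φ k l) := by
  have hz : ∀ τ, φ τ ≠ 0 → 3 / 4 ≤ |τ| ∧ |τ| ≤ 8 / 3 := fun τ h => hφ.supp (subset_tsupport φ h)
  have hcs : HasCompactSupport φ := by
    refine HasCompactSupport.intro (isCompact_closedBall (0 : ℝ) (8 / 3)) fun τ hτ => ?_
    by_contra h
    exact hτ (by simpa using (hz τ h).2)
  obtain ⟨C, hC⟩ := hcs.exists_bound_of_continuous hφ.smooth.continuous
  have hC0 : 0 ≤ C := (norm_nonneg _).trans (hC 0)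
  refine ⟨⟨C, hC0⟩ * ⟨C, hC0⟩, fun k l => ⟨?_, fun ξ => ?_, fun ξ h => ?_⟩⟩
  · exact (hφ.hasTemperateGrowth_abs l).1.mul (hφ.hasTemperateGrowth_hnorm k).1
  · rw [blockSymbol, norm_mul, Complex.norm_real, Complex.norm_real]
    exact mul_le_mul (hC _) (hC _) (norm_nonneg _) hC0
  · simp only [blockSymbol, ne_eq, mul_eq_zero, Complex.ofReal_eq_zero, not_or] at h
    exact ⟨dyadic_bounds (hnorm_nonneg ξ) (hz _ h.2), dyadic_bounds (abs_nonneg _) (hz _ h.1)⟩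

/-! ### Bernstein inequality -/

theorem measure_shell_le (k l : ℤ) :
    volume (shell k l) ≤
      ENNReal.ofReal ((16 / 3) ^ 3 * ((2 : ℝ) ^ k * (2 : ℝ) ^ k * (2 : ℝ) ^ l)) := by
  let r : Fin 3 → ℝ := ![8 / 3 * (2 : ℝ) ^ k, 8 / 3 * (2 : ℝ) ^ k, 8 / 3 * (2 : ℝ) ^ l]
  have hsub : shell k l ⊆ (MeasurableEquiv.toLp 2 (Fin 3 → ℝ)).symm ⁻¹' (Set.Icc (-r) r) := by
    intro ξ hξ
    have h0 := abs_le.1 ((abs_zero_le_hnorm ξ).trans hξ.1.2)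
    have h1 := abs_le.1 ((abs_one_le_hnorm ξ).trans hξ.1.2)
    have h2 := abs_le.1 hξ.2.2
    refine ⟨fun i => ?_, fun i => ?_⟩ <;> fin_cases i
    exacts [h0.1, h1.1, h2.1, h0.2, h1.2, h2.2]
  refine (measure_mono hsub).trans ?_
  rw [(EuclideanSpace.volume_preserving_symm_measurableEquiv_toLp (Fin 3)).measure_preimage
    measurableSet_Icc.nullMeasurableSet, Real.volume_Icc_pi, Fin.prod_univ_three,
    ← ENNReal.ofReal_mul, ← ENNReal.ofReal_mul]
  · refine ENNReal.ofReal_le_ofReal (le_of_eq ?_)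
    simp only [r, Pi.neg_apply, Matrix.cons_val_zero, Matrix.cons_val_one, Matrix.cons_val]
    ring
  all_goals
    simp only [r, Pi.neg_apply, Matrix.cons_val_zero, Matrix.cons_val_one]
    have : (0 : ℝ) < 2 ^ k := by positivity
    nlinarith

/-- Plancherel's identity for Schwartz functions. -/
theorem eLpNorm_fourier (w : 𝓢(R3, ℂ)) :
    eLpNorm (⇑(𝓕 w : 𝓢(R3, ℂ))) 2 volume = eLpNorm (⇑w) 2 volume := by
  have h := SchwartzMap.norm_fourier_toL2_eq w
  rw [SchwartzMap.norm_toLp, SchwartzMap.norm_toLp] at h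
  exact (ENNReal.toReal_eq_toReal_iff' ((𝓕 w : 𝓢(R3, ℂ)).memLp 2 volume).eLpNorm_ne_top
    (w.memLp 2 volume).eLpNorm_ne_top).1 h

theorem eLpNorm_fourierInv (u : 𝓢(R3, ℂ)) :
    eLpNorm (⇑(𝓕⁻ u : 𝓢(R3, ℂ))) 2 volume = eLpNorm (⇑u) 2 volume := by
  rw [← eLpNorm_fourier, FourierTransform.fourier_fourierInv_eq]

/-- Interpolation between `L²` and `L^∞`. -/
theorem eLpNorm_three_le {f : R3 → ℂ} {S N : ℝ≥0∞} (hS : ∀ x, ‖f x‖ₑ ≤ S)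
    (hN : eLpNorm f 2 volume ≤ N) (hf : AEStronglyMeasurable f volume) :
    eLpNorm f 3 volume ≤ (S * N ^ 2) ^ (1 / 3 : ℝ) := by
  have h3 : eLpNorm f 3 volume = (∫⁻ x, ‖f x‖ₑ ^ 3) ^ (1 / 3 : ℝ) := by
    rw [eLpNorm_eq_lintegral_rpow_enorm_toReal (by norm_num) (by norm_num)]
    simp
  have h2 : eLpNorm f 2 volume ^ 2 = ∫⁻ x, ‖f x‖ₑ ^ 2 := by
    rw [eLpNorm_eq_lintegral_rpow_enorm_toReal (by norm_num) (by norm_num)]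
    simp only [ENNReal.toReal_ofNat, ENNReal.rpow_ofNat]
    rw [← ENNReal.rpow_natCast, ← ENNReal.rpow_mul]
    norm_num
  rw [h3]
  refine ENNReal.rpow_le_rpow ?_ (by norm_num)
  calc ∫⁻ x, ‖f x‖ₑ ^ 3 ≤ ∫⁻ x, S * ‖f x‖ₑ ^ 2 := by
        refine lintegral_mono fun x => ?_
        rw [pow_succ, mul_comm]
        exact mul_le_mul_left (hS x) _
    _ = S * ∫⁻ x, ‖f x‖ₑ ^ 2 := lintegral_const_mul'' _ (hf.enorm.pow_const 2)
    _ ≤ S * N ^ 2 := by rw [← h2]; gcongr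

/-- Anisotropic Bernstein inequality from `L²` to `L³`. -/
theorem IsLocalized.eLpNorm_op_le {k l : ℤ} {M : ℝ≥0} {n : R3 → ℂ} (hn : IsLocalized k l M n)
    (u : 𝓢(R3, ℂ)) :
    eLpNorm (⇑(op n u)) 3 volume ≤
      6 * (2 : ℝ≥0∞) ^ (k / 3 + l / 6 : ℝ) * M * eLpNorm (⇑u) 2 volume := by
  set w := SchwartzMap.smulLeftCLM ℂ n (𝓕⁻ u) with hw
  set N := (M : ℝ≥0∞) * eLpNorm (⇑u) 2 volume with hNdef
  set V := volume (shell k l)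
  have hwn : ∀ ξ, w ξ = n ξ * (𝓕⁻ u) ξ := hn.op_eq u
  have hN : eLpNorm (⇑w) 2 volume ≤ N := by
    rw [hNdef, ← eLpNorm_fourierInv u]
    refine (eLpNorm_le_nnreal_smul_eLpNorm_of_ae_le_mul (c := M) (.of_forall fun ξ => ?_) 2)
    rw [hwn]
    exact_mod_cast (norm_mul_le _ _).trans
      (mul_le_mul_of_nonneg_right (hn.bound ξ) (norm_nonneg _))
  have h1 : eLpNorm (⇑w) 1 volume ≤ N * V ^ (1 / 2 : ℝ) := by
    have hs : Function.support (⇑w) ⊆ shell k l := fun ξ hξ =>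
      hn.supp ξ fun h => hξ (by simp [hwn, h])
    rw [← eLpNorm_restrict_eq_of_support_subset hs]
    have := eLpNorm_le_eLpNorm_mul_rpow_measure_univ (μ := volume.restrict (shell k l)) (p := 1)
      (q := 2) (by norm_num) (w.continuous.aestronglyMeasurable)
    refine this.trans ?_
    rw [Measure.restrict_apply_univ]
    have e : (1 / (1 : ℝ≥0∞).toReal - 1 / (2 : ℝ≥0∞).toReal) = (1 / 2 : ℝ) := by norm_num
    rw [e]
    gcongr
    exact (eLpNorm_mono_measure _ Measure.restrict_le_self).trans hN
  have hS : ∀ x, ‖(op n u) x‖ₑ ≤ N * V ^ (1 / 2 : ℝ) := fun x => by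
    refine le_trans ?_ h1
    have h := SchwartzMap.norm_fourier_apply_le_toLp_one w x
    rw [SchwartzMap.norm_toLp] at h
    rw [← ofReal_norm, ← ENNReal.ofReal_toReal (w.memLp 1 volume).eLpNorm_ne_top]
    exact ENNReal.ofReal_le_ofReal h
  have hop : eLpNorm (⇑(op n u)) 2 volume ≤ N := by rwa [op, eLpNorm_fourier]
  have h3 := eLpNorm_three_le hS hop
    (op n u).continuous.aestronglyMeasurable
  refine h3.trans ?_
  have hV : V ≤ 6 ^ 6 * (2 : ℝ≥0∞) ^ (2 * k + l : ℝ) := by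
    refine (measure_shell_le k l).trans ?_
    have e : (2 : ℝ≥0∞) ^ (2 * k + l : ℝ) =
        ENNReal.ofReal ((2 : ℝ) ^ k * (2 : ℝ) ^ k * (2 : ℝ) ^ l) := by
      rw [← ENNReal.ofReal_ofNat 2, ENNReal.ofReal_rpow_of_pos (by norm_num)]
      congr 1
      rw [← zpow_add₀ (by norm_num), ← zpow_add₀ (by norm_num), ← Real.rpow_intCast]
      push_cast
      ring_nf
    have e6 : (6 : ℝ≥0∞) ^ 6 = ENNReal.ofReal (6 ^ 6) := by
      rw [ENNReal.ofReal_pow (by norm_num), ENNReal.ofReal_ofNat]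
    rw [e, e6, ← ENNReal.ofReal_mul (by norm_num)]
    refine ENNReal.ofReal_le_ofReal (mul_le_mul_of_nonneg_right (by norm_num) (by positivity))
  calc (N * V ^ (1 / 2 : ℝ) * N ^ 2) ^ (1 / 3 : ℝ)
      = (N ^ 3) ^ (1 / 3 : ℝ) * (V ^ (1 / 2 : ℝ)) ^ (1 / 3 : ℝ) := by
        rw [← ENNReal.mul_rpow_of_nonneg _ _ (by norm_num)]
        ring_nf
    _ = N * V ^ (1 / 6 : ℝ) := by
        rw [← ENNReal.rpow_natCast, ← ENNReal.rpow_mul, ← ENNReal.rpow_mul]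
        norm_num
    _ ≤ N * (6 ^ 6 * (2 : ℝ≥0∞) ^ (2 * k + l : ℝ)) ^ (1 / 6 : ℝ) := by gcongr
    _ = N * (6 * (2 : ℝ≥0∞) ^ (k / 3 + l / 6 : ℝ)) := by
        rw [ENNReal.mul_rpow_of_nonneg _ _ (by norm_num), ← ENNReal.rpow_natCast,
          ← ENNReal.rpow_mul, ← ENNReal.rpow_mul]
        norm_num
        ring_nf
    _ = 6 * (2 : ℝ≥0∞) ^ (k / 3 + l / 6 : ℝ) * M * eLpNorm (⇑u) 2 volume := by
        rw [hNdef]; ring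

/-! ### Translations and derivatives -/

theorem eLpNorm_ne_zero_of_ne_zero {g : 𝓢(R3, ℂ)} (hg : g ≠ 0) {p : ℝ≥0∞} (hp : p ≠ 0) :
    eLpNorm (⇑g) p volume ≠ 0 := by
  intro h
  rw [eLpNorm_eq_zero_iff g.continuous.aestronglyMeasurable hp] at h
  refine hg (SchwartzMap.ext fun x => ?_)
  have := (g.continuous.ae_eq_iff_eq volume (continuous_const (y := (0 : ℂ)))).1 h
  exact congrFun this x

theorem enorm_apply_le_top_mul (T : 𝓢'(R3, ℂ)) (g : 𝓢(R3, ℂ)) {p : ℝ≥0∞} (hp : p ≠ 0) :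
    ‖T g‖ₑ ≤ ⊤ * eLpNorm (⇑g) p volume := by
  by_cases hg : g = 0
  · simp [hg]
  · rw [ENNReal.top_mul (eLpNorm_ne_zero_of_ne_zero hg hp)]
    exact le_top

/-- An `L^p` bound on a tempered distribution extends from test functions to Schwartz functions. -/
theorem enorm_apply_le_of_hasCompactSupport (T : 𝓢'(R3, ℂ)) {p : ℝ≥0∞} [hp : Fact (1 ≤ p)]
    (A : ℝ≥0∞) (h : ∀ u : 𝓢(R3, ℂ), HasCompactSupport (⇑u) → ‖T u‖ₑ ≤ A * eLpNorm (⇑u) p volume)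
    (g : 𝓢(R3, ℂ)) : ‖T g‖ₑ ≤ A * eLpNorm (⇑g) p volume := by
  by_cases hA : A = ⊤
  · rw [hA]
    exact enorm_apply_le_top_mul T g (one_pos.trans_le hp.out).ne'
  lift A to ℝ≥0 using hA
  have hiff : ∀ u : 𝓢(R3, ℂ), ‖T u‖ₑ ≤ A * eLpNorm (⇑u) p volume ↔
      ‖T u‖ ≤ A * ‖SchwartzMap.toLpCLM ℂ ℂ p (volume : Measure R3) u‖ := fun u => by
    have hfin := (u.memLp p (volume : Measure R3)).eLpNorm_ne_top
    rw [SchwartzMap.toLpCLM_apply, SchwartzMap.norm_toLp,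
      ← ENNReal.toReal_le_toReal (by finiteness) (by finiteness)]
    simp
  have hcl : IsClosed {u : 𝓢(R3, ℂ) | ‖T u‖ ≤
      A * ‖SchwartzMap.toLpCLM ℂ ℂ p (volume : Measure R3) u‖} :=
    isClosed_le (by fun_prop) (by fun_prop)
  rw [hiff]
  exact closure_minimal (fun u hu => (hiff u).1 (h u hu)) hcl (dense_hasCompactSupport g)

theorem hasDerivAt_integral_translate {f : R3 → ℂ} (hf : LocallyIntegrable f volume)
    {u : 𝓢(R3, ℂ)} (hu : HasCompactSupport (⇑u)) (a : R3) (t : ℝ) :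
    HasDerivAt (fun t : ℝ => ∫ x, u (x - t • a) * f x)
      (-∫ x, (∂_{a} u) (x - t • a) * f x) t := by
  let g : R3 → ℂ := fun y => u (-y)
  have hg : HasCompactSupport g := hu.comp_homeomorph (Homeomorph.neg R3)
  have hgc : ContDiff ℝ 1 g := ((u.smooth ⊤).comp contDiff_neg).of_le (by exact_mod_cast le_top)
  have hgd : ∀ y, fderiv ℝ g y a = -(∂_{a} u) (-y) := fun y => by
    have h1 : g = fun y => u ((-1 : ℝ) • y) := by ext y; simp [g]
    rw [SchwartzMap.lineDerivOp_apply_eq_fderiv, h1]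
    have h2 := fderiv_comp_smul (𝕜 := ℝ) (f := ⇑u) (x := y) (-1)
    rw [h2]
    simp
  have key := hg.hasFDerivAt_convolution_right (ContinuousLinearMap.mul ℝ ℂ) (μ := volume) hf hgc
    (t • a)
  have hline : HasDerivAt (fun t : ℝ => t • a) a t := by
    simpa using (hasDerivAt_id t).smul_const a
  have h2 := key.comp_hasDerivAt t hline
  rw [convolution_precompR_apply _ hf (hg.fderiv ℝ) (hgc.continuous_fderiv (by norm_num))] at h2
  refine (h2.congr_deriv ?_).congr_of_eventuallyEq (.of_forall fun s => ?_)
  · rw [convolution, ← integral_neg]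
    refine integral_congr_ae (.of_forall fun x => ?_)
    simp [hgd, mul_comm]
  · simp only [Function.comp_apply, convolution]
    refine integral_congr_ae (.of_forall fun x => ?_)
    simp [g, mul_comm]

/-- The translate `x ↦ u (x - a)`. -/
def translate (a : R3) (u : 𝓢(R3, ℂ)) : 𝓢(R3, ℂ) := SchwartzMap.compSubConstCLM ℂ a u

theorem hasCompactSupport_translate {u : 𝓢(R3, ℂ)} (hu : HasCompactSupport (⇑u)) (a : R3) :
    HasCompactSupport (⇑(translate a u)) :=
  hu.comp_homeomorph (Homeomorph.subRight a)

theorem eLpNorm_translate (u : 𝓢(R3, ℂ)) (a : R3) (p : ℝ≥0∞) :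
    eLpNorm (⇑(translate a u)) p volume = eLpNorm (⇑u) p volume :=
  eLpNorm_comp_measurePreserving u.continuous.aestronglyMeasurable
    (measurePreserving_sub_right volume a)

theorem lineDeriv_translate (u : 𝓢(R3, ℂ)) (a m x : R3) :
    (∂_{m} (translate a u)) x = (∂_{m} u) (x - a) := by
  rw [SchwartzMap.lineDerivOp_apply_eq_fderiv, SchwartzMap.lineDerivOp_apply_eq_fderiv]
  change fderiv ℝ (fun x => u (x - a)) x m = _
  rw [fderiv_comp_sub]

/-- If `∫ b ∂_a u` is bounded by `Y ‖u‖_{L²}`, then the translates of `b` along `a` are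
`Y`-Lipschitz in `L²`. -/
theorem eLpNorm_sub_translate_le {b : R3 → ℝ} (hb : LocallyIntegrable b volume) {Y : ℝ≥0} {a : R3}
    (h : ∀ u : 𝓢(R3, ℂ), HasCompactSupport (⇑u) →
      ‖∫ x, (∂_{a} u) x * (b x : ℂ)‖ₑ ≤ Y * eLpNorm (⇑u) 2 volume) (t : ℝ) :
    eLpNorm (fun x => b (x + t • a) - b x) 2 volume ≤ Y * ‖t‖ₑ := by
  have hbt : LocallyIntegrable (fun x => b (x + t • a)) volume :=
    (locallyIntegrable_map_homeomorph (Homeomorph.addRight (t • a))).1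
      (by simpa using (measurePreserving_add_right volume (t • a)).map_eq.symm ▸ hb)
  have hbc : LocallyIntegrable (fun x => (b x : ℂ)) volume :=
    locallyIntegrable_ofReal hb
  have hbtc : LocallyIntegrable (fun x => (b (x + t • a) : ℂ)) volume :=
    locallyIntegrable_ofReal hbt
  have e0 : (Y : ℝ≥0∞) * ‖t‖ₑ = ((Y * ‖t‖₊ : ℝ≥0) : ℝ≥0∞) := by
    rw [ENNReal.coe_mul]; rfl
  rw [e0]
  refine eLpNorm_two_le_of_duality (fun x => b (x + t • a) - b x) (hbt.sub hb) _ fun u hu => ?_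
  -- The integral to be bounded is `Φ t - Φ 0`, where the derivative of `Φ` is controlled by `h`.
  let Φ : ℝ → ℂ := fun t => ∫ x, u (x - t • a) * (b x : ℂ)
  have hΦ : ∀ s, HasDerivAt Φ (-∫ x, (∂_{a} u) (x - s • a) * (b x : ℂ)) s := fun s =>
    hasDerivAt_integral_translate hbc hu a s
  have hfin := (u.memLp 2 (volume : Measure R3)).eLpNorm_ne_top
  have hbd : ∀ s : ℝ, ‖-∫ x, (∂_{a} u) (x - s • a) * (b x : ℂ)‖ ≤
      (Y * eLpNorm (⇑u) 2 volume).toReal := fun s => by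
    have := h (translate (s • a) u) (hasCompactSupport_translate hu _)
    simp only [lineDeriv_translate, eLpNorm_translate] at this
    rw [norm_neg, ← toReal_enorm]
    exact ENNReal.toReal_mono (by finiteness) this
  have hmv : ‖Φ t - Φ 0‖ ≤ (Y * eLpNorm (⇑u) 2 volume).toReal * ‖t - 0‖ :=
    convex_univ.norm_image_sub_le_of_norm_hasDerivWithin_le
      (fun s _ => (hΦ s).hasDerivWithinAt)
      (fun s _ => hbd s) (Set.mem_univ 0) (Set.mem_univ t)
  have hi1 : Integrable fun x => u x * (b (x + t • a) : ℂ) :=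
    hbtc.integrable_smul_left_of_hasCompactSupport u.continuous hu
  have hi2 : Integrable fun x => u x * (b x : ℂ) :=
    hbc.integrable_smul_left_of_hasCompactSupport u.continuous hu
  have hΦt : Φ t = ∫ x, u x * (b (x + t • a) : ℂ) := by
    have := integral_add_right_eq_self (μ := volume) (fun x => u (x - t • a) * (b x : ℂ)) (t • a)
    simp only [add_sub_cancel_right] at this
    exact this.symm
  have heq : ∫ x, u x * ((b (x + t • a) - b x : ℝ) : ℂ) = Φ t - Φ 0 := by
    rw [hΦt, ← show ∫ x, u x * (b x : ℂ) = Φ 0 by simp [Φ], ← integral_sub hi1 hi2]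
    refine integral_congr_ae (.of_forall fun x => ?_)
    push_cast
    ring
  rw [heq, ← ofReal_norm]
  refine (ENNReal.ofReal_le_ofReal hmv).trans (le_of_eq ?_)
  rw [ENNReal.ofReal_mul (by positivity), ENNReal.ofReal_toReal (by finiteness), sub_zero,
    ofReal_norm, ENNReal.coe_mul]
  change _ = (Y : ℝ≥0∞) * ‖t‖ₑ * _
  ring

/-! ### The nonlinear change of unknown -/

/-- Every real number is `± p⁴`, and then its signed power of exponent `3/4` is `± p³`. -/
theorem exists_fourth_root (a : ℝ) : ∃ p : ℝ, 0 ≤ p ∧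
    ((a = p ^ 4 ∧ signedPow (3 / 4) a = p ^ 3) ∨ (a = -p ^ 4 ∧ signedPow (3 / 4) a = -p ^ 3)) := by
  refine ⟨|a| ^ (1 / 4 : ℝ), by positivity, ?_⟩
  have h4 : (|a| ^ (1 / 4 : ℝ)) ^ 4 = |a| := by
    rw [← Real.rpow_natCast, ← Real.rpow_mul (abs_nonneg a)]; norm_num
  have h3 : (|a| ^ (1 / 4 : ℝ)) ^ 3 = |a| ^ (3 / 4 : ℝ) := by
    rw [← Real.rpow_natCast, ← Real.rpow_mul (abs_nonneg a)]; norm_num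
  rw [h4, h3, signedPow]
  rcases lt_trichotomy a 0 with h | h | h
  · right
    rw [abs_of_neg h]
    refine ⟨by ring, ?_⟩
    rw [div_neg, div_self h.ne]
    ring
  · left; simp [h]
  · left
    rw [abs_of_pos h, div_self h.ne']
    exact ⟨rfl, one_mul _⟩

theorem cube_rpow_third {p : ℝ} (hp : 0 ≤ p) : (p ^ 3) ^ (1 / 3 : ℝ) = p := by
  rw [← Real.rpow_natCast, ← Real.rpow_mul hp]
  norm_num

theorem abs_eq_abs_signedPow_rpow (a : ℝ) : |a| = |signedPow (3 / 4) a| ^ (4 / 3 : ℝ) := by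
  obtain ⟨p, hp, h⟩ := exists_fourth_root a
  have e : (p ^ 3) ^ (4 / 3 : ℝ) = p ^ 4 := by
    rw [← Real.rpow_natCast, ← Real.rpow_mul hp, ← Real.rpow_natCast]
    norm_num
  rcases h with ⟨h1, h2⟩ | ⟨h1, h2⟩ <;> rw [h2, h1] <;> try simp only [abs_neg]
  all_goals
    rw [abs_of_nonneg (by positivity), abs_of_nonneg (by positivity), e]

/-- Local Lipschitz bound for the inverse of `a ↦ signedPow (3 / 4) a`. -/
theorem abs_sub_le_signedPow (a a' : ℝ) :
    |a' - a| ≤ (|signedPow (3 / 4) a'| ^ (1 / 3 : ℝ) + |signedPow (3 / 4) a| ^ (1 / 3 : ℝ)) *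
      |signedPow (3 / 4) a' - signedPow (3 / 4) a| := by
  have key : ∀ p q : ℝ, 0 ≤ p → 0 ≤ q → |p ^ 4 - q ^ 4| ≤ (p + q) * |p ^ 3 - q ^ 3| := by
    intro p q hp hq
    have h1 : p ^ 4 - q ^ 4 = (p - q) * ((p + q) * (p ^ 2 + q ^ 2)) := by ring
    have h2 : p ^ 3 - q ^ 3 = (p - q) * (p ^ 2 + p * q + q ^ 2) := by ring
    rw [h1, h2, abs_mul (p - q), abs_mul (p - q),
      abs_of_nonneg (a := (p + q) * (p ^ 2 + q ^ 2)) (by positivity),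
      abs_of_nonneg (a := p ^ 2 + p * q + q ^ 2) (by positivity)]
    have h3 : 0 ≤ |p - q| * ((p + q) * (p * q)) := by positivity
    nlinarith [h3]
  have key' : ∀ p q : ℝ, 0 ≤ p → 0 ≤ q → |p ^ 4 + q ^ 4| ≤ (p + q) * |p ^ 3 + q ^ 3| := by
    intro p q hp hq
    rw [abs_of_nonneg (by positivity), abs_of_nonneg (by positivity)]
    have : 0 ≤ p * q ^ 3 + q * p ^ 3 := by positivity
    nlinarith
  obtain ⟨q, hq, h⟩ := exists_fourth_root a
  obtain ⟨p, hp, h'⟩ := exists_fourth_root a'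
  rcases h with ⟨h1, h2⟩ | ⟨h1, h2⟩ <;> rcases h' with ⟨h3, h4⟩ | ⟨h3, h4⟩ <;>
    rw [h2, h4, h1, h3] <;> try simp only [abs_neg]
  all_goals
    rw [abs_of_nonneg (a := p ^ 3) (by positivity), abs_of_nonneg (a := q ^ 3) (by positivity),
      cube_rpow_third hp, cube_rpow_third hq]
  · exact key p q hp hq
  · rw [show -p ^ 4 - q ^ 4 = -(p ^ 4 + q ^ 4) by ring,
      show -p ^ 3 - q ^ 3 = -(p ^ 3 + q ^ 3) by ring,
      abs_neg, abs_neg]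
    exact key' p q hp hq
  · rw [sub_neg_eq_add, sub_neg_eq_add]
    exact key' p q hp hq
  · rw [show -p ^ 4 - -q ^ 4 = -(p ^ 4 - q ^ 4) by ring,
      show -p ^ 3 - -q ^ 3 = -(p ^ 3 - q ^ 3) by ring, abs_neg, abs_neg]
    exact key p q hp hq

instance holderTriple_three : ENNReal.HolderTriple (3 / 2) 3 1 where
  inv_add_inv_eq_inv := by
    rw [ENNReal.inv_div (by simp) (by simp)]
    refine (ENNReal.toReal_eq_toReal_iff' (by finiteness) (by finiteness)).1 ?_
    rw [ENNReal.toReal_add (by finiteness) (by finiteness)]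
    simp
    norm_num

instance holderTriple_six : ENNReal.HolderTriple 6 2 (3 / 2) where
  inv_add_inv_eq_inv := by
    rw [ENNReal.inv_div (by simp) (by simp)]
    refine (ENNReal.toReal_eq_toReal_iff' (by finiteness) (by finiteness)).1 ?_
    rw [ENNReal.toReal_add (by finiteness) (by finiteness)]
    simp
    norm_num

/-- Hölder's inequality for a pairing. -/
theorem enorm_integral_mul_le {p q : ℝ≥0∞} [ENNReal.HolderTriple p q 1] {f g : R3 → ℂ}
    (hf : AEStronglyMeasurable f volume) (hg : AEStronglyMeasurable g volume) :
    ‖∫ x, g x * f x‖ₑ ≤ eLpNorm f p volume * eLpNorm g q volume := by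
  have h := eLpNorm_smul_le_mul_eLpNorm (p := p) (q := q) (r := 1) hg hf
  refine le_trans ?_ h
  rw [eLpNorm_one_eq_lintegral_enorm]
  refine (enorm_integral_le_lintegral_enorm _).trans (le_of_eq ?_)
  refine lintegral_congr fun x => ?_
  simp [mul_comm]

section Vorticity

variable {T : 𝓢'(R3, ℂ)} {w : R3 → ℝ}

theorem IsGivenBy.aestronglyMeasurable (h : IsGivenBy T fun x => (w x : ℂ)) :
    AEStronglyMeasurable w volume := by
  simpa using! (Complex.continuous_re.comp_aestronglyMeasurable h.1.aestronglyMeasurable)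

/-- `‖ω‖_{L^{3/2}} = ‖ω_{3/4}‖_{L²}^{4/3}`. -/
theorem eLpNorm_eq_signedPow (w : R3 → ℝ) :
    eLpNorm (fun x => (w x : ℂ)) (3 / 2) volume =
      eLpNorm (fun x => signedPow (3 / 4) (w x)) 2 volume ^ (4 / 3 : ℝ) := by
  have h := eLpNorm_norm_rpow (p := 3 / 2) (μ := (volume : Measure R3))
    (fun x => signedPow (3 / 4) (w x)) (q := 4 / 3) (by norm_num)
  have e : (3 / 2 : ℝ≥0∞) * ENNReal.ofReal (4 / 3) = 2 := by
    rw [show (3 / 2 : ℝ≥0∞) = ENNReal.ofReal (3 / 2) by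
      rw [ENNReal.ofReal_div_of_pos (by norm_num)]; simp, ← ENNReal.ofReal_mul (by norm_num)]
    norm_num
  rw [e] at h
  rw [← h]
  refine eLpNorm_congr_norm_ae (.of_forall fun x => ?_)
  rw [Complex.norm_real, Real.norm_eq_abs, Real.norm_eq_abs, Real.norm_eq_abs,
    abs_eq_abs_signedPow_rpow]
  exact (abs_of_nonneg (by positivity)).symm

theorem eLpNorm_rpow_third (b : R3 → ℝ) :
    eLpNorm (fun x => |b x| ^ (1 / 3 : ℝ)) 6 volume = eLpNorm b 2 volume ^ (1 / 3 : ℝ) := by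
  have h := eLpNorm_norm_rpow (p := 6) (μ := (volume : Measure R3)) b (q := 1 / 3) (by norm_num)
  have e : (6 : ℝ≥0∞) * ENNReal.ofReal (1 / 3) = 2 := by
    rw [← ENNReal.ofReal_ofNat 6, ← ENNReal.ofReal_mul (by norm_num)]
    norm_num
  rw [e] at h
  rw [← h]
  rfl

/-- `ω` acts on `L³` with norm at most `‖ω_{3/4}‖_{L²}^{4/3}`. -/
theorem IsGivenBy.enorm_apply_le (h : IsGivenBy T fun x => (w x : ℂ)) (g : 𝓢(R3, ℂ)) :
    ‖T g‖ₑ ≤ eLpNorm (fun x => signedPow (3 / 4) (w x)) 2 volume ^ (4 / 3 : ℝ) *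
      eLpNorm (⇑g) 3 volume := by
  have : Fact ((1 : ℝ≥0∞) ≤ 3) := ⟨by norm_num⟩
  refine enorm_apply_le_of_hasCompactSupport T _ (fun u hu => ?_) g
  rw [h.2 u hu, ← eLpNorm_eq_signedPow]
  exact enorm_integral_mul_le h.1.aestronglyMeasurable u.continuous.aestronglyMeasurable

/-- Integration by parts against complex test functions. -/
theorem IsWeakGradient.integral_lineDeriv {b : R3 → ℝ} {G : R3 → R3} (hG : IsWeakGradient b G)
    {u : 𝓢(R3, ℂ)} (hu : HasCompactSupport (⇑u)) (i : Fin 3) :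
    ∫ x, (∂_{e i} u) x * (b x : ℂ) = -∫ x, u x * (G x i : ℂ) := by
  obtain ⟨hb, hGl, hibp⟩ := hG
  have hbc : LocallyIntegrable (fun x => (b x : ℂ)) volume :=
    locallyIntegrable_ofReal hb
  have hGc : LocallyIntegrable (fun x => (G x i : ℂ)) volume := fun x => by
    obtain ⟨s, hs, hi⟩ := hGl x
    exact ⟨s, hs, ((EuclideanSpace.proj i : R3 →L[ℝ] ℝ).integrable_comp hi).ofReal⟩
  have hdu : HasCompactSupport (⇑(∂_{e i} u : 𝓢(R3, ℂ))) :=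
    hu.of_isClosed_subset (isClosed_tsupport _) (SchwartzMap.tsupport_lineDerivOp_subset (e i) u)
  have hi1 : Integrable fun x => (∂_{e i} u) x * (b x : ℂ) :=
    hbc.integrable_smul_left_of_hasCompactSupport (∂_{e i} u : 𝓢(R3, ℂ)).continuous hdu
  have hi2 : Integrable fun x => u x * (G x i : ℂ) :=
    hGc.integrable_smul_left_of_hasCompactSupport u.continuous hu
  have aux : ∀ L : ℂ →L[ℝ] ℝ, (∀ (z : ℂ) (r : ℝ), L (z * r) = r * L z) →
      L (∫ x, (∂_{e i} u) x * (b x : ℂ)) = L (-∫ x, u x * (G x i : ℂ)) := fun L hL => by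
    rw [map_neg, ← L.integral_comp_comm hi1, ← L.integral_comp_comm hi2]
    have h1 := hibp (fun x => L (u x)) (L.contDiff.comp (u.smooth ⊤))
      (hu.comp_left (g := L) (map_zero L)) i
    have h2 : ∀ x, fderiv ℝ (fun x => L (u x)) x (e i) = L ((∂_{e i} u) x) := fun x => by
      rw [SchwartzMap.lineDerivOp_apply_eq_fderiv]
      have := (L.hasFDerivAt.comp x u.differentiableAt.hasFDerivAt).fderiv
      change fderiv ℝ (L ∘ u) x (e i) = _
      rw [this]
      rfl
    simpa only [h2, hL] using h1
  refine Complex.ext (aux Complex.reCLM fun z r => ?_) (aux Complex.imCLM fun z r => ?_)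
  · simp [mul_comm]
  · simp [mul_comm]

/-- `‖∇b‖_{L²}` bounds `∫ b ∂_i u` by duality. -/
theorem enorm_integral_lineDeriv_le {b : R3 → ℝ} {u : 𝓢(R3, ℂ)}
    (hu : HasCompactSupport (⇑u)) (i : Fin 3) :
    ‖∫ x, (∂_{e i} u) x * (b x : ℂ)‖ₑ ≤ gradLpNorm 2 b * eLpNorm (⇑u) 2 volume := by
  by_cases h0 : u = 0
  · subst h0
    simp
  have hne := eLpNorm_ne_zero_of_ne_zero h0 (p := 2) (by norm_num)
  have hfin := (u.memLp 2 (volume : Measure R3)).eLpNorm_ne_top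
  rw [← ENNReal.div_le_iff hne hfin]
  refine le_iInf₂ fun G hG => ?_
  rw [ENNReal.div_le_iff hne hfin, hG.integral_lineDeriv hu, enorm_neg]
  have hGm : AEStronglyMeasurable (fun x => (G x i : ℂ)) volume :=
    (Complex.continuous_ofReal.comp
      (EuclideanSpace.proj i : R3 →L[ℝ] ℝ).continuous).comp_aestronglyMeasurable
        hG.2.1.aestronglyMeasurable
  refine (enorm_integral_mul_le (p := 2) (q := 2) hGm
    u.continuous.aestronglyMeasurable).trans ?_
  gcongr
  refine eLpNorm_mono fun x => ?_
  rw [Complex.norm_real]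
  exact PiLp.norm_apply_le (G x) i

/-- Translates of `ω` in `L^{3/2}` are controlled by translates of `ω_{3/4}` in `L²`. -/
theorem eLpNorm_translate_sub_le {w b : R3 → ℝ} (hb : ∀ x, b x = signedPow (3 / 4) (w x))
    (hbm : AEStronglyMeasurable b volume) (a : R3) {D : ℝ≥0∞}
    (hD : eLpNorm (fun x => b (x + a) - b x) 2 volume ≤ D) :
    eLpNorm (fun x => ((w (x + a) - w x : ℝ) : ℂ)) (3 / 2) volume ≤
      2 * eLpNorm b 2 volume ^ (1 / 3 : ℝ) * D := by
  have hmp : MeasurePreserving (fun x : R3 => x + a) := measurePreserving_add_right volume a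
  let b' : R3 → ℝ := fun x => b (x + a)
  have hbtm : AEStronglyMeasurable b' volume := hbm.comp_measurePreserving hmp
  have hp : ∀ f : R3 → ℝ, AEStronglyMeasurable f volume →
      AEStronglyMeasurable (fun x => |f x| ^ (1 / 3 : ℝ)) volume := fun f hf =>
    ((Real.continuous_rpow_const (by norm_num)).comp continuous_abs).comp_aestronglyMeasurable hf
  let F : R3 → ℝ := fun x => |b' x| ^ (1 / 3 : ℝ) + |b x| ^ (1 / 3 : ℝ)
  have hF : AEStronglyMeasurable F volume := (hp _ hbtm).add (hp _ hbm)
  have h6 : eLpNorm F 6 volume ≤ 2 * eLpNorm b 2 volume ^ (1 / 3 : ℝ) := by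
    refine (eLpNorm_add_le (hp _ hbtm) (hp _ hbm) (by norm_num)).trans ?_
    rw [eLpNorm_rpow_third b, eLpNorm_rpow_third b',
      show eLpNorm b' 2 volume = eLpNorm b 2 volume from
        eLpNorm_comp_measurePreserving hbm hmp, two_mul]
  have hle : eLpNorm (fun x => ((w (x + a) - w x : ℝ) : ℂ)) (3 / 2) volume ≤
      eLpNorm (F • fun x => b' x - b x) (3 / 2) volume := by
    refine eLpNorm_mono fun x => ?_
    have hF0 : 0 ≤ F x := by positivity
    rw [Complex.norm_real, Real.norm_eq_abs, Pi.smul_apply', smul_eq_mul, norm_mul,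
      Real.norm_eq_abs, Real.norm_eq_abs, abs_of_nonneg hF0]
    have := abs_sub_le_signedPow (w x) (w (x + a))
    rw [← hb, ← hb] at this
    exact this
  exact hle.trans ((eLpNorm_smul_le_mul_eLpNorm (p := 6) (q := 2) (hbtm.sub hbm) hF).trans
    (mul_le_mul' h6 hD))

/-- `∂_j ω` acts on `L³` with norm at most `2 ‖ω_{3/4}‖_{L²}^{1/3} ‖∇ω_{3/4}‖_{L²}`. -/
theorem IsGivenBy.enorm_lineDeriv_apply_le (h : IsGivenBy T fun x => (w x : ℂ)) (j : Fin 3)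
    (g : 𝓢(R3, ℂ)) :
    ‖(∂_{e j} T) g‖ₑ ≤ 2 * (eLpNorm (fun x => signedPow (3 / 4) (w x)) 2 volume ^ (1 / 3 : ℝ) *
      gradLpNorm 2 (fun x => signedPow (3 / 4) (w x))) * eLpNorm (⇑g) 3 volume := by
  set b : R3 → ℝ := fun x => signedPow (3 / 4) (w x) with hb
  set X := eLpNorm b 2 volume with hX
  -- For `X = 0` and `Y = ∞` the right-hand side is `0`, and indeed `T = 0`.
  by_cases hX0 : X = 0
  · have := h.enorm_apply_le (-∂_{e j} g)
    rw [← hX, hX0, ENNReal.zero_rpow_of_pos (by norm_num), zero_mul, nonpos_iff_eq_zero] at this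
    rw [TemperedDistribution.lineDerivOp_apply_apply, this]
    exact zero_le
  by_cases hY : gradLpNorm 2 b = ⊤
  · rw [hY, ENNReal.mul_top, ENNReal.mul_top (by norm_num)]
    · exact enorm_apply_le_top_mul _ g (by norm_num)
    · simp [ENNReal.rpow_eq_zero_iff, hX0]
  obtain ⟨Y, hY'⟩ : ∃ Y : ℝ≥0, (Y : ℝ≥0∞) = gradLpNorm 2 b := ⟨_, ENNReal.coe_toNNReal hY⟩
  have hbl : LocallyIntegrable b volume := by
    have : gradLpNorm 2 b < ⊤ := lt_top_iff_ne_top.2 hY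
    simp only [gradLpNorm, iInf_lt_iff] at this
    obtain ⟨G, hG, -⟩ := this
    exact hG.1
  have hwm := h.aestronglyMeasurable
  have hbm : AEStronglyMeasurable b volume := hbl.aestronglyMeasurable
  have hmp : ∀ a : R3, MeasurePreserving (fun x : R3 => x + a) := fun a =>
    measurePreserving_add_right volume a
  have htr : ∀ t : ℝ, eLpNorm (fun x => ((w (x + t • e j) - w x : ℝ) : ℂ)) (3 / 2) volume ≤
      2 * (X ^ (1 / 3 : ℝ) * Y) * ‖t‖ₑ := by
    intro t
    have h2 := eLpNorm_sub_translate_le hbl (Y := Y) (a := e j)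
      (fun u hu => hY' ▸ enorm_integral_lineDeriv_le hu j) t
    refine (eLpNorm_translate_sub_le (fun _ => rfl) hbm (t • e j) h2).trans (le_of_eq ?_)
    rw [← hX]
    ring
  rw [← hY']
  have : Fact ((1 : ℝ≥0∞) ≤ 3) := ⟨by norm_num⟩
  refine enorm_apply_le_of_hasCompactSupport _ _ (fun u hu => ?_) g
  have hdu : HasCompactSupport (⇑(∂_{e j} u : 𝓢(R3, ℂ))) :=
    hu.of_isClosed_subset (isClosed_tsupport _) (SchwartzMap.tsupport_lineDerivOp_subset (e j) u)
  -- For `X = ∞` and `Y = 0` the bound `htr` still says that `ω` is invariant by translation along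
  -- `e j`, and the argument below applies.
  by_cases hXtop : 2 * (X ^ (1 / 3 : ℝ) * Y) = ⊤
  · rw [hXtop]
    exact enorm_apply_le_top_mul _ u (by norm_num)
  have hfin := (u.memLp 3 (volume : Measure R3)).eLpNorm_ne_top
  -- `(∂_j T) u` is the derivative at `0` of `Φ`, which is Lipschitz by `htr`.
  let Φ : ℝ → ℂ := fun t => ∫ x, u (x - t • e j) * (w x : ℂ)
  have hΦ := hasDerivAt_integral_translate h.1 hu (e j) 0
  have hΦ0 : -∫ x, (∂_{e j} u) (x - (0 : ℝ) • e j) * (w x : ℂ) = (∂_{e j} T) u := by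
    rw [TemperedDistribution.lineDerivOp_apply_apply, map_neg, h.2 _ hdu]
    simp
  rw [hΦ0] at hΦ
  have hlip : ∀ t : ℝ, ‖Φ t - Φ 0‖ ≤
      (2 * (X ^ (1 / 3 : ℝ) * Y) * eLpNorm (⇑u) 3 volume).toReal * ‖t - 0‖ := by
    intro t
    have hwt : LocallyIntegrable (fun x => (w (x + t • e j) : ℂ)) volume :=
      (locallyIntegrable_map_homeomorph (f := fun x => (w x : ℂ))
        (Homeomorph.addRight (t • e j))).1 (by simpa using (hmp (t • e j)).map_eq.symm ▸ h.1)
    have hi1 : Integrable fun x => u x * (w (x + t • e j) : ℂ) :=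
      hwt.integrable_smul_left_of_hasCompactSupport u.continuous hu
    have hi2 : Integrable fun x => u x * (w x : ℂ) :=
      h.1.integrable_smul_left_of_hasCompactSupport u.continuous hu
    have hΦt : Φ t = ∫ x, u x * (w (x + t • e j) : ℂ) := by
      have := integral_add_right_eq_self (μ := volume)
        (fun x => u (x - t • e j) * (w x : ℂ)) (t • e j)
      simp only [add_sub_cancel_right] at this
      exact this.symm
    have heq : Φ t - Φ 0 = ∫ x, u x * ((w (x + t • e j) - w x : ℝ) : ℂ) := by
      rw [hΦt, ← show ∫ x, u x * (w x : ℂ) = Φ 0 by simp [Φ], ← integral_sub hi1 hi2]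
      refine integral_congr_ae (.of_forall fun x => ?_)
      push_cast
      ring
    have hm : AEStronglyMeasurable (fun x => ((w (x + t • e j) - w x : ℝ) : ℂ)) volume :=
      Complex.continuous_ofReal.comp_aestronglyMeasurable
        ((hwm.comp_measurePreserving (hmp _)).sub hwm)
    have hE : ‖Φ t - Φ 0‖ₑ ≤ 2 * (X ^ (1 / 3 : ℝ) * Y) * eLpNorm (⇑u) 3 volume * ‖t‖ₑ := by
      rw [heq]
      refine (enorm_integral_mul_le (p := 3 / 2) (q := 3) hm
        u.continuous.aestronglyMeasurable).trans ?_
      refine (mul_le_mul_left (htr t) _).trans (le_of_eq (by ring))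
    have := ENNReal.toReal_mono (ENNReal.mul_ne_top (by finiteness) (by simp)) hE
    simpa using this
  have hder : ‖(∂_{e j} T) u‖ ≤ (2 * (X ^ (1 / 3 : ℝ) * Y) * eLpNorm (⇑u) 3 volume).toReal := by
    have := hΦ.hasFDerivAt.le_of_lip' ENNReal.toReal_nonneg (.of_forall hlip)
    simpa using this
  rw [← ofReal_norm, ← ENNReal.ofReal_toReal (ENNReal.mul_ne_top hXtop hfin)]
  exact ENNReal.ofReal_le_ofReal hder

end Vorticity

/-! ### Real interpolation sums -/

theorem tsum_two_rpow_neg_abs_ne_top {δ : ℝ} (hδ : 0 < δ) :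
    ∑' j : ℤ, (2 : ℝ≥0∞) ^ (δ - δ * |(j : ℝ)|) ≠ ⊤ := by
  have hr0 : (0 : ℝ) < 2 ^ (-δ) := by positivity
  have hr1 : (2 : ℝ) ^ (-δ) < 1 := Real.rpow_lt_one_of_one_lt_of_neg one_lt_two (by linarith)
  have hs : Summable fun j : ℤ => (2 : ℝ) ^ (δ - δ * |(j : ℝ)|) := by
    have hn : Summable fun n : ℕ => (2 : ℝ) ^ (δ - δ * (n : ℝ)) := by
      refine ((summable_geometric_of_lt_one hr0.le hr1).mul_left (2 ^ δ)).congr fun n => ?_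
      rw [← Real.rpow_natCast, ← Real.rpow_mul (by norm_num), ← Real.rpow_add (by norm_num)]
      ring_nf
    refine Summable.of_nat_of_neg (hn.congr fun n => ?_) (hn.congr fun n => ?_) <;> simp
  have he : ∀ j : ℤ, (2 : ℝ≥0∞) ^ (δ - δ * |(j : ℝ)|) =
      ENNReal.ofReal ((2 : ℝ) ^ (δ - δ * |(j : ℝ)|)) := fun j => by
    rw [← ENNReal.ofReal_rpow_of_pos (by norm_num), ENNReal.ofReal_ofNat]
  simp_rw [he]
  exact hs.tsum_ofReal_ne_top

theorem two_rpow_add (x y : ℝ) : (2 : ℝ≥0∞) ^ (x + y) = 2 ^ x * 2 ^ y :=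
  ENNReal.rpow_add _ _ (by norm_num) (by norm_num)

theorem two_rpow_le {x y : ℝ} (h : x ≤ y) : (2 : ℝ≥0∞) ^ x ≤ 2 ^ y :=
  ENNReal.rpow_le_rpow_of_exponent_le (by norm_num) h

theorem exists_eq_mul_two_rpow {a b : ℝ≥0∞} (ha : a ≠ 0) (ha' : a ≠ ⊤) (hb : b ≠ 0) (hb' : b ≠ ⊤) :
    ∃ y : ℝ, b = a * 2 ^ y := by
  have hc : b / a ≠ ⊤ := ENNReal.div_ne_top hb' ha
  have hc0 : 0 < (b / a).toReal := ENNReal.toReal_pos (ENNReal.div_ne_zero.2 ⟨hb, ha'⟩) hc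
  refine ⟨Real.logb 2 (b / a).toReal, ?_⟩
  rw [← ENNReal.ofReal_ofNat 2, ENNReal.ofReal_rpow_of_pos (by norm_num),
    Real.rpow_logb (by norm_num) (by norm_num) hc0, ENNReal.ofReal_toReal hc,
    ENNReal.mul_div_cancel ha ha']

/-- Summation of `2^{kp} min(a, 2^{-kμ} b)` over all dyadic scales: the sum is dominated by the
scale at which the two terms of the minimum are equal. -/
theorem exists_tsum_min_le {p μ : ℝ} (hp : 0 < p) (hpμ : p < μ) :
    ∃ K : ℝ≥0, ∀ a b : ℝ≥0∞,
      ∑' k : ℤ, (2 : ℝ≥0∞) ^ (k * p : ℝ) * min a (2 ^ (-k * μ : ℝ) * b) ≤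
        K * (a ^ (1 - p / μ) * b ^ (p / μ)) := by
  have hμ : 0 < μ := hp.trans hpμ
  have hr0 : 0 < p / μ := div_pos hp hμ
  have hr1 : 0 < 1 - p / μ := by rw [sub_pos, div_lt_one hμ]; exact hpμ
  set δ := min p (μ - p) with hδdef
  have hδ : 0 < δ := lt_min hp (by linarith)
  have hδ1 : δ ≤ p := min_le_left _ _
  have hδ2 : δ ≤ μ - p := min_le_right _ _
  set K := ∑' j : ℤ, (2 : ℝ≥0∞) ^ (δ - δ * |(j : ℝ)|) with hK
  have hKtop : K ≠ ⊤ := tsum_two_rpow_neg_abs_ne_top hδ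
  refine ⟨K.toNNReal + 1, fun a b => ?_⟩
  -- The degenerate values of `a` and `b` come first; then `b = a 2^{xμ}`, and the `k`-th term is at
  -- most `a 2^{xp} 2^{-δ|k - x|}`.
  rcases eq_or_ne a 0 with rfl | ha
  · simp
  rcases eq_or_ne b 0 with rfl | hb
  · simp
  have hK1 : ((K.toNNReal + 1 : ℝ≥0) : ℝ≥0∞) ≠ 0 := by positivity
  rcases eq_or_ne a ⊤ with rfl | ha'
  · rw [ENNReal.top_rpow_of_pos hr1, ENNReal.top_mul, ENNReal.mul_top hK1]
    · exact le_top
    · simp [ENNReal.rpow_eq_zero_iff, hb, hr0.not_gt]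
  rcases eq_or_ne b ⊤ with rfl | hb'
  · rw [ENNReal.top_rpow_of_pos hr0, ENNReal.mul_top, ENNReal.mul_top hK1]
    · exact le_top
    · simp [ENNReal.rpow_eq_zero_iff, ha, hr1.not_gt]
  obtain ⟨y, hy⟩ := exists_eq_mul_two_rpow ha ha' hb hb'
  set x := y / μ with hx
  have hxy : y = x * μ := by rw [hx, div_mul_cancel₀ _ hμ.ne']
  have hrhs : a ^ (1 - p / μ) * b ^ (p / μ) = a * 2 ^ (x * p) := by
    rw [hy, ENNReal.mul_rpow_of_nonneg _ _ hr0.le, ← mul_assoc,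
      ← ENNReal.rpow_add_of_nonneg _ _ hr1.le hr0.le, ← ENNReal.rpow_mul,
      show 1 - p / μ + p / μ = 1 by ring, ENNReal.rpow_one, hx]
    congr 2
    ring
  have hterm : ∀ k : ℤ, (2 : ℝ≥0∞) ^ (k * p : ℝ) * min a (2 ^ (-k * μ : ℝ) * b) ≤
      a * 2 ^ (x * p) * 2 ^ (δ - δ * |((k - ⌊x⌋ : ℤ) : ℝ)|) := by
    intro k
    have habs : |((k - ⌊x⌋ : ℤ) : ℝ)| ≤ |k - x| + 1 := by
      push_cast
      have h1 := Int.floor_le x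
      have h2 := Int.lt_floor_add_one x
      calc |(k : ℝ) - ⌊x⌋| = |(k - x) + (x - ⌊x⌋)| := by ring_nf
        _ ≤ |k - x| + |x - ⌊x⌋| := abs_add_le _ _
        _ ≤ |k - x| + 1 := by
          gcongr
          rw [abs_of_nonneg (by linarith)]
          linarith
    have hfl : (2 : ℝ≥0∞) ^ (-(δ * |k - x|)) ≤ 2 ^ (δ - δ * |((k - ⌊x⌋ : ℤ) : ℝ)|) :=
      two_rpow_le (by nlinarith)
    rcases le_total (k : ℝ) x with hkx | hkx
    · calc (2 : ℝ≥0∞) ^ (k * p : ℝ) * min a (2 ^ (-k * μ : ℝ) * b)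
          ≤ 2 ^ (k * p : ℝ) * a := by gcongr; exact min_le_left _ _
        _ ≤ 2 ^ (x * p + -(δ * |k - x|)) * a := by
          refine mul_le_mul_left (two_rpow_le ?_) _
          rw [abs_of_nonpos (by linarith)]
          nlinarith
        _ = a * 2 ^ (x * p) * 2 ^ (-(δ * |k - x|)) := by rw [two_rpow_add]; ring
        _ ≤ _ := by gcongr
    · calc (2 : ℝ≥0∞) ^ (k * p : ℝ) * min a (2 ^ (-k * μ : ℝ) * b)
          ≤ 2 ^ (k * p : ℝ) * (2 ^ (-k * μ : ℝ) * b) := by gcongr; exact min_le_right _ _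
        _ = 2 ^ (k * p + -k * μ + y : ℝ) * a := by rw [hy, two_rpow_add, two_rpow_add]; ring
        _ ≤ 2 ^ (x * p + -(δ * |k - x|)) * a := by
          refine mul_le_mul_left (two_rpow_le ?_) _
          rw [abs_of_nonneg (by linarith), hxy]
          nlinarith
        _ = a * 2 ^ (x * p) * 2 ^ (-(δ * |k - x|)) := by rw [two_rpow_add]; ring
        _ ≤ _ := by gcongr
  calc ∑' k : ℤ, (2 : ℝ≥0∞) ^ (k * p : ℝ) * min a (2 ^ (-k * μ : ℝ) * b)
      ≤ ∑' k : ℤ, a * 2 ^ (x * p) * 2 ^ (δ - δ * |((k - ⌊x⌋ : ℤ) : ℝ)|) :=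
        ENNReal.tsum_le_tsum hterm
    _ = a * 2 ^ (x * p) * K := by
        rw [ENNReal.tsum_mul_left, hK,
          ← (Equiv.subRight ⌊x⌋).tsum_eq fun j : ℤ => (2 : ℝ≥0∞) ^ (δ - δ * |(j : ℝ)|)]
        rfl
    _ ≤ ((K.toNNReal + 1 : ℝ≥0) : ℝ≥0∞) * (a ^ (1 - p / μ) * b ^ (p / μ)) := by
        rw [hrhs, mul_comm]
        gcongr
        rw [ENNReal.coe_add, ENNReal.coe_toNNReal hKtop]
        exact le_self_add

/-- The value at the scale `(k, l)` of a quantity bounded by `A` and whose gradient is bounded by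
`B`. -/
def gain (A B : ℝ≥0∞) (k l : ℤ) : ℝ≥0∞ :=
  min A (min ((2 : ℝ≥0∞) ^ (-k : ℝ) * B) ((2 : ℝ≥0∞) ^ (-l : ℝ) * B))

/-- The anisotropic version of `exists_tsum_min_le`. The double sum is split into two simple ones by
`m = m^μ m^{1-μ}`, where `μ = p / (p + q)` makes both of them converge. -/
theorem exists_tsum_gain_le {p q : ℝ} (hp : 0 < p) (hq : 0 < q) (hpq : p + q < 1) :
    ∃ K : ℝ≥0, ∀ A B : ℝ≥0∞,
      ∑' k : ℤ, ∑' l : ℤ, (2 : ℝ≥0∞) ^ (k * p + l * q : ℝ) * gain A B k l ≤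
        K * (A ^ (1 - (p + q)) * B ^ (p + q)) := by
  have hs : 0 < p + q := by linarith
  set μ := p / (p + q) with hμ
  set ν := q / (p + q) with hν
  have hμ0 : 0 < μ := div_pos hp hs
  have hν0 : 0 < ν := div_pos hq hs
  have hμν : μ + ν = 1 := by rw [hμ, hν]; field_simp
  have hpμ : p < μ := by rw [hμ, lt_div_iff₀ hs]; nlinarith
  have hqν : q < ν := by rw [hν, lt_div_iff₀ hs]; nlinarith
  obtain ⟨K₁, h₁⟩ := exists_tsum_min_le hp hpμ
  obtain ⟨K₂, h₂⟩ := exists_tsum_min_le hq hqν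
  refine ⟨K₁ * K₂, fun A B => ?_⟩
  have hmin : ∀ (k : ℤ) {r : ℝ}, 0 < r →
      min A ((2 : ℝ≥0∞) ^ (-k : ℝ) * B) ^ r = min (A ^ r) (2 ^ (-k * r : ℝ) * B ^ r) := by
    intro k r hr
    rw [(ENNReal.monotone_rpow_of_nonneg hr.le).map_min, ENNReal.mul_rpow_of_nonneg _ _ hr.le,
      ← ENNReal.rpow_mul]
  have hle : ∀ k l : ℤ, (2 : ℝ≥0∞) ^ (k * p + l * q : ℝ) * gain A B k l ≤
      (2 ^ (k * p : ℝ) * min (A ^ μ) (2 ^ (-k * μ : ℝ) * B ^ μ)) *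
        (2 ^ (l * q : ℝ) * min (A ^ ν) (2 ^ (-l * ν : ℝ) * B ^ ν)) := by
    intro k l
    have h1 : gain A B k l ^ μ ≤ min (A ^ μ) (2 ^ (-k * μ : ℝ) * B ^ μ) := by
      rw [← hmin k hμ0]
      exact ENNReal.rpow_le_rpow (min_le_min_left _ (min_le_left _ _)) hμ0.le
    have h2 : gain A B k l ^ ν ≤ min (A ^ ν) (2 ^ (-l * ν : ℝ) * B ^ ν) := by
      rw [← hmin l hν0]
      exact ENNReal.rpow_le_rpow (min_le_min_left _ (min_le_right _ _)) hν0.le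
    calc (2 : ℝ≥0∞) ^ (k * p + l * q : ℝ) * gain A B k l
        = (2 ^ (k * p : ℝ) * gain A B k l ^ μ) * (2 ^ (l * q : ℝ) * gain A B k l ^ ν) := by
          have : gain A B k l = gain A B k l ^ μ * gain A B k l ^ ν := by
            rw [← ENNReal.rpow_add_of_nonneg _ _ hμ0.le hν0.le, hμν, ENNReal.rpow_one]
          conv_lhs => rw [this]
          rw [two_rpow_add]
          ring
      _ ≤ _ := mul_le_mul' (mul_le_mul_right h1 _) (mul_le_mul_right h2 _)
  have hA : (A ^ μ) ^ (1 - p / μ) * (A ^ ν) ^ (1 - q / ν) = A ^ (1 - (p + q)) := by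
    rw [← ENNReal.rpow_mul, ← ENNReal.rpow_mul,
      show μ * (1 - p / μ) = μ - p by field_simp, show ν * (1 - q / ν) = ν - q by field_simp,
      ← ENNReal.rpow_add_of_nonneg _ _ (by linarith) (by linarith)]
    congr 1
    linarith
  have hB : (B ^ μ) ^ (p / μ) * (B ^ ν) ^ (q / ν) = B ^ (p + q) := by
    rw [← ENNReal.rpow_mul, ← ENNReal.rpow_mul, mul_div_cancel₀ _ hμ0.ne',
      mul_div_cancel₀ _ hν0.ne', ENNReal.rpow_add_of_nonneg _ _ hp.le hq.le]
  calc ∑' k : ℤ, ∑' l : ℤ, (2 : ℝ≥0∞) ^ (k * p + l * q : ℝ) * gain A B k l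
      ≤ ∑' k : ℤ, ∑' l : ℤ, (2 ^ (k * p : ℝ) * min (A ^ μ) (2 ^ (-k * μ : ℝ) * B ^ μ)) *
        (2 ^ (l * q : ℝ) * min (A ^ ν) (2 ^ (-l * ν : ℝ) * B ^ ν)) :=
        ENNReal.tsum_le_tsum fun k => ENNReal.tsum_le_tsum fun l => hle k l
    _ = (∑' k : ℤ, 2 ^ (k * p : ℝ) * min (A ^ μ) (2 ^ (-k * μ : ℝ) * B ^ μ)) *
        ∑' l : ℤ, 2 ^ (l * q : ℝ) * min (A ^ ν) (2 ^ (-l * ν : ℝ) * B ^ ν) := by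
        simp_rw [ENNReal.tsum_mul_left, ENNReal.tsum_mul_right]
    _ ≤ (K₁ * ((A ^ μ) ^ (1 - p / μ) * (B ^ μ) ^ (p / μ))) *
        (K₂ * ((A ^ ν) ^ (1 - q / ν) * (B ^ ν) ^ (q / ν))) := mul_le_mul' (h₁ _ _) (h₂ _ _)
    _ = (K₁ * K₂ : ℝ≥0) * (A ^ (1 - (p + q)) * B ^ (p + q)) := by
        rw [← hA, ← hB, ENNReal.coe_mul]
        ring

/-! ### Bounds on localized pieces -/

/-- All pieces of `T` localized at the scale `(k, l)` have `L²` norm at most `A ρ(k, l)`, up to the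
size of the symbol. -/
def HasScaleBound (T : 𝓢'(R3, ℂ)) (ρ : ℤ → ℤ → ℝ≥0∞) (A : ℝ≥0∞) : Prop :=
  ∀ (k l : ℤ) (M : ℝ≥0) (n : R3 → ℂ), IsLocalized k l M n → ∀ u : 𝓢(R3, ℂ),
    ‖T (op n u)‖ₑ ≤ A * ρ k l * M * eLpNorm (⇑u) 2 volume

theorem enorm_two_pi_I_inv_le : ‖(2 * Real.pi * Complex.I : ℂ)⁻¹‖ₑ ≤ 1 := by
  rw [← ofReal_norm, ENNReal.ofReal_le_one, norm_inv]
  refine inv_le_one_of_one_le₀ ?_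
  simp only [norm_mul, Complex.norm_ofNat, Complex.norm_real, Complex.norm_I, mul_one,
    Real.norm_of_nonneg Real.pi_pos.le]
  linarith [Real.pi_gt_three]

theorem coe_div_bound_le (k : ℤ) (M : ℝ≥0) :
    ((4 / 3 * 2 ^ (-k) * M : ℝ≥0) : ℝ≥0∞) ≤ 2 * (2 : ℝ≥0∞) ^ (-k : ℝ) * M := by
  have : (4 / 3 * 2 ^ (-k) * M : ℝ≥0) ≤ 2 * 2 ^ (-k) * M := by
    gcongr
    rw [div_le_iff₀ (by norm_num)]
    norm_num
  refine (ENNReal.coe_le_coe.2 this).trans (le_of_eq ?_)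
  rw [ENNReal.coe_mul, ENNReal.coe_mul, ENNReal.coe_zpow (by norm_num), ← ENNReal.rpow_intCast]
  push_cast
  rfl

/-- Since `∂_j` acts on the scale `(k, l)` like a multiplication by `2^k` or `2^l`, a bound on the
gradient improves a scale bound. -/
theorem HasScaleBound.gain {T : 𝓢'(R3, ℂ)} {ρ : ℤ → ℤ → ℝ≥0∞} {A B : ℝ≥0∞}
    (hA : HasScaleBound T ρ A) (hB : ∀ j : Fin 3, HasScaleBound (∂_{e j} T) ρ B)
    {k l : ℤ} {M : ℝ≥0} {n : R3 → ℂ} (hn : IsLocalized k l M n) (u : 𝓢(R3, ℂ)) :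
    ‖T (op n u)‖ₑ ≤ gain A B k l * (4 * ρ k l * M * eLpNorm (⇑u) 2 volume) := by
  set N := eLpNorm (⇑u) 2 volume
  have hpiece : ∀ (j : Fin 3) (m : ℤ) (n' : R3 → ℂ), IsLocalized k l (4 / 3 * 2 ^ (-m) * M) n' →
      ‖(2 * Real.pi * Complex.I : ℂ)⁻¹ * (∂_{e j} T) (op n' u)‖ₑ ≤
        2 * (2 : ℝ≥0∞) ^ (-m : ℝ) * B * (ρ k l * M * N) := by
    intro j m n' hn'
    rw [enorm_mul]
    calc ‖(2 * Real.pi * Complex.I : ℂ)⁻¹‖ₑ * ‖(∂_{e j} T) (op n' u)‖ₑ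
        ≤ 1 * (B * ρ k l * (2 * (2 : ℝ≥0∞) ^ (-m : ℝ) * M) * N) := by
          refine mul_le_mul' enorm_two_pi_I_inv_le ((hB j _ _ _ _ hn' u).trans ?_)
          gcongr
          exact coe_div_bound_le m M
      _ = _ := by ring
  have h1 : ‖T (op n u)‖ₑ ≤ A * (4 * ρ k l * M * N) := by
    refine (hA k l M n hn u).trans ?_
    calc A * ρ k l * M * N = A * (1 * ρ k l * M * N) := by ring
      _ ≤ _ := by gcongr; norm_num
  have h2 : ‖T (op n u)‖ₑ ≤ (2 : ℝ≥0∞) ^ (-k : ℝ) * B * (4 * ρ k l * M * N) := by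
    rw [apply_op_eq_divH hn]
    refine (enorm_add_le _ _).trans ((add_le_add (hpiece 0 k _ (hn.divH abs_zero_le_hnorm))
      (hpiece 1 k _ (hn.divH abs_one_le_hnorm))).trans (le_of_eq ?_))
    ring
  have h3 : ‖T (op n u)‖ₑ ≤ (2 : ℝ≥0∞) ^ (-l : ℝ) * B * (4 * ρ k l * M * N) := by
    rw [apply_op_eq_divV hn]
    refine (hpiece 2 l _ hn.divV).trans ?_
    calc 2 * (2 : ℝ≥0∞) ^ (-l : ℝ) * B * (ρ k l * M * N)
        = (2 : ℝ≥0∞) ^ (-l : ℝ) * B * (2 * ρ k l * M * N) := by ring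
      _ ≤ _ := by gcongr; norm_num
  unfold AnisoBesov.gain
  rcases min_choice A (min ((2 : ℝ≥0∞) ^ (-k : ℝ) * B) ((2 : ℝ≥0∞) ^ (-l : ℝ) * B)) with h | h
  · rwa [h]
  · rw [h]
    rcases min_choice ((2 : ℝ≥0∞) ^ (-k : ℝ) * B) ((2 : ℝ≥0∞) ^ (-l : ℝ) * B) with h | h <;>
      rwa [h]

/-- The weight produced by the Bernstein inequality from `L^{3/2}` to `L²`. -/
def bernsteinWeight (k l : ℤ) : ℝ≥0∞ := 6 * (2 : ℝ≥0∞) ^ (k / 3 + l / 6 : ℝ)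

/-- The inverse of the weight of `𝓗_θ`. -/
def thetaWeight (θ : ℝ) (k l : ℤ) : ℝ≥0∞ := 2 * (2 : ℝ≥0∞) ^ (k * (1 / 2 - θ) + l * θ : ℝ)

theorem hasScaleBound_of_enorm_le {T : 𝓢'(R3, ℂ)} {A : ℝ≥0∞}
    (h : ∀ g : 𝓢(R3, ℂ), ‖T g‖ₑ ≤ A * eLpNorm (⇑g) 3 volume) :
    HasScaleBound T bernsteinWeight A := fun k l M n hn u => by
  refine (h _).trans ((mul_le_mul_right (hn.eLpNorm_op_le u) A).trans (le_of_eq ?_))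
  rw [bernsteinWeight]
  ring

theorem one_le_two_rpow_mul {x : ℝ} {k : ℤ} (h : x ≤ 8 / 3 * (2 : ℝ) ^ k) {t : ℝ}
    (ht : 0 ≤ t) : 1 ≤ (2 : ℝ≥0∞) ^ ((k + 2) * t : ℝ) * ENNReal.ofReal x ^ (-t) := by
  have h1 : ENNReal.ofReal x ≤ (2 : ℝ≥0∞) ^ (k + 2 : ℝ) := by
    rw [← ENNReal.ofReal_ofNat 2, ENNReal.ofReal_rpow_of_pos (by norm_num)]
    refine ENNReal.ofReal_le_ofReal (h.trans ?_)
    rw [Real.rpow_add (by norm_num), Real.rpow_intCast]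
    have : (0 : ℝ) < 2 ^ k := by positivity
    norm_num
    linarith
  rw [ENNReal.rpow_mul, ENNReal.rpow_neg]
  set a := ((2 : ℝ≥0∞) ^ (k + 2 : ℝ)) ^ t with ha
  have hle : ENNReal.ofReal x ^ t ≤ a := ENNReal.rpow_le_rpow h1 ht
  have ha0 : a ≠ 0 := by simp [ha, ← ENNReal.rpow_mul]
  have hat : a ≠ ⊤ := by simp [ha, ← ENNReal.rpow_mul]
  calc (1 : ℝ≥0∞) = a * a⁻¹ := (ENNReal.mul_inv_cancel ha0 hat).symm
    _ ≤ _ := by gcongr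

/-- `‖T‖_{𝓗_θ}` is a scale bound, by the Cauchy–Schwarz inequality on the Fourier side. -/
theorem hasScaleBound_hThetaNorm {θ : ℝ} (hθ : θ ∈ Set.Ioo (0 : ℝ) (1 / 2)) (T : 𝓢'(R3, ℂ)) :
    HasScaleBound T (thetaWeight θ) (hThetaNorm θ T) := fun k l M n hn u => by
  set w := SchwartzMap.smulLeftCLM ℂ n (𝓕⁻ u) with hw
  set N := eLpNorm (⇑u) 2 volume with hN
  have hwn : ∀ ξ, w ξ = n ξ * (𝓕⁻ u) ξ := hn.op_eq u
  by_cases h0 : u = 0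
  · simp [h0, op]
  have hN0 : N ≠ 0 := eLpNorm_ne_zero_of_ne_zero h0 (by norm_num)
  have hNt : N ≠ ⊤ := (u.memLp 2 (volume : Measure R3)).eLpNorm_ne_top
  by_cases hM : M = 0
  · have : op n u = 0 := by
      have hz : w = 0 := SchwartzMap.ext fun ξ => by
        have : n ξ = 0 := by simpa [hM] using hn.bound ξ
        simp [hwn, this]
      rw [op, ← hw, hz]
      simp
    simp [this]
  have hc0 : thetaWeight θ k l * M * N ≠ 0 := by
    simp [thetaWeight, hM, hN0, ENNReal.rpow_eq_zero_iff]
  have hct : thetaWeight θ k l * M * N ≠ ⊤ := by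
    refine ENNReal.mul_ne_top (ENNReal.mul_ne_top ?_ (by simp)) hNt
    exact ENNReal.mul_ne_top (by norm_num)
      (ENNReal.rpow_ne_top_of_ne_zero (by norm_num) (by norm_num))
  rw [mul_assoc, mul_assoc, ← mul_assoc (thetaWeight θ k l), ← ENNReal.div_le_iff hc0 hct]
  refine le_iInf₂ fun f hf => ?_
  rw [ENNReal.div_le_iff hc0 hct]
  have hsupp : HasCompactSupport (⇑w) := by
    have : (⇑w) = fun ξ => n ξ * (𝓕⁻ u) ξ := funext hwn
    rw [this]
    exact hn.hasCompactSupport.mul_right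
  have hTw : T (op n u) = ∫ ξ, w ξ * f ξ := hf.2 w hsupp
  have hfm : AEStronglyMeasurable f volume := hf.1.aestronglyMeasurable
  have hhm : Measurable hnorm := continuous_hnorm.measurable
  let W : R3 → ℝ≥0∞ := fun ξ =>
    ENNReal.ofReal (hnorm ξ) ^ (-(1 / 2 - θ)) * ENNReal.ofReal |ξ 2| ^ (-θ) * ‖f ξ‖ₑ
  have hWm : AEMeasurable W volume := by
    refine AEMeasurable.mul (Measurable.aemeasurable ?_) hfm.enorm
    fun_prop
  have hpt : ∀ ξ, ‖w ξ * f ξ‖ₑ ≤ thetaWeight θ k l * M * (‖(𝓕⁻ u) ξ‖ₑ * W ξ) := by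
    intro ξ
    by_cases hξ : n ξ = 0
    · simp [hwn, hξ]
    have hs := hn.supp ξ hξ
    have h1 := one_le_two_rpow_mul hs.1.2 (t := 1 / 2 - θ) (by linarith [hθ.2])
    have h2 := one_le_two_rpow_mul hs.2.2 (t := θ) hθ.1.le
    have hnM : ‖n ξ‖ₑ ≤ M := by
      rw [← ofReal_norm]
      exact ENNReal.ofReal_le_of_le_toReal (by simpa using hn.bound ξ)
    have hth : thetaWeight θ k l =
        (2 : ℝ≥0∞) ^ ((k + 2) * (1 / 2 - θ) : ℝ) * (2 : ℝ≥0∞) ^ ((l + 2) * θ : ℝ) := by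
      rw [thetaWeight, ← two_rpow_add]
      nth_rewrite 1 [← ENNReal.rpow_one 2]
      rw [← two_rpow_add]
      congr 1
      ring
    rw [hwn, enorm_mul, enorm_mul]
    calc ‖n ξ‖ₑ * ‖(𝓕⁻ u) ξ‖ₑ * ‖f ξ‖ₑ ≤ 1 * 1 * (M * ‖(𝓕⁻ u) ξ‖ₑ * ‖f ξ‖ₑ) := by
          rw [one_mul, one_mul]
          gcongr
      _ ≤ _ := mul_le_mul_left (mul_le_mul' h1 h2) _
      _ = _ := by rw [hth]; ring
  have hCS := ENNReal.lintegral_mul_le_Lp_mul_Lq (volume : Measure R3)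
    Real.HolderConjugate.two_two (f := fun ξ => ‖(𝓕⁻ u) ξ‖ₑ) (g := W)
    (𝓕⁻ u : 𝓢(R3, ℂ)).continuous.aestronglyMeasurable.enorm hWm
  have hNeq : (∫⁻ ξ, ‖(𝓕⁻ u) ξ‖ₑ ^ (2 : ℝ)) ^ (1 / 2 : ℝ) = N := by
    rw [hN, ← eLpNorm_fourierInv,
      eLpNorm_eq_lintegral_rpow_enorm_toReal (by norm_num) (by norm_num)]
    simp
  have hWeq : ∀ ξ, W ξ ^ (2 : ℝ) = ENNReal.ofReal (hnorm ξ) ^ (2 * (-(1 / 2) + θ)) *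
      ENNReal.ofReal |ξ 2| ^ (2 * -θ) * ‖f ξ‖ₑ ^ 2 := by
    intro ξ
    rw [ENNReal.mul_rpow_of_nonneg _ _ (by norm_num), ENNReal.mul_rpow_of_nonneg _ _ (by norm_num),
      ← ENNReal.rpow_mul, ← ENNReal.rpow_mul, ENNReal.rpow_ofNat]
    congr 3 <;> ring
  simp only [Pi.mul_apply] at hCS
  rw [hNeq] at hCS
  simp_rw [hWeq] at hCS
  rw [hTw]
  calc ‖∫ ξ, w ξ * f ξ‖ₑ ≤ ∫⁻ ξ, ‖w ξ * f ξ‖ₑ := enorm_integral_le_lintegral_enorm _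
    _ ≤ ∫⁻ ξ, thetaWeight θ k l * M * (‖(𝓕⁻ u) ξ‖ₑ * W ξ) := lintegral_mono hpt
    _ = thetaWeight θ k l * M * ∫⁻ ξ, ‖(𝓕⁻ u) ξ‖ₑ * W ξ :=
        lintegral_const_mul'' _
          ((𝓕⁻ u : 𝓢(R3, ℂ)).continuous.aestronglyMeasurable.enorm.mul hWm)
    _ ≤ _ := mul_le_mul_right hCS _
    _ = _ := by ring

theorem hThetaNorm_lineDeriv_le (θ : ℝ) (T : 𝓢'(R3, ℂ)) (j : Fin 3) :
    hThetaNorm θ (∂_{e j} T) ≤ gradHThetaNorm θ T := by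
  rw [gradHThetaNorm]
  calc hThetaNorm θ (∂_{e j} T) = (hThetaNorm θ (∂_{e j} T) ^ 2) ^ (1 / 2 : ℝ) := by
        rw [← ENNReal.rpow_natCast, ← ENNReal.rpow_mul]
        norm_num
    _ ≤ _ := ENNReal.rpow_le_rpow
        (Finset.single_le_sum (f := fun j : Fin 3 => hThetaNorm θ (∂_{e j} T) ^ 2)
          (fun _ _ => zero_le) (Finset.mem_univ j)) (by norm_num)

theorem HasScaleBound.mono {T : 𝓢'(R3, ℂ)} {ρ : ℤ → ℤ → ℝ≥0∞} {A B : ℝ≥0∞}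
    (h : HasScaleBound T ρ A) (hAB : A ≤ B) : HasScaleBound T ρ B := fun k l M n hn u =>
  (h k l M n hn u).trans (by gcongr)

/-! ### Conclusion -/

/-- The bound on the blocks of a distribution which, up to a factor `2^{-k}`, is the sum of a piece
of the horizontal divergence and a piece of the vorticity. -/
theorem lpNorm_block_le {φ : ℝ → ℝ} (hφ : IsDyadicCutoff φ) {M : ℝ≥0} {k l : ℤ}
    (hn : IsLocalized k l M (blockSymbol φ k l)) {S a ζ : 𝓢'(R3, ℂ)} {ρ ρ' : ℤ → ℤ → ℝ≥0∞}
    {A B A' B' : ℝ≥0∞} (hA : HasScaleBound ζ ρ A)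
    (hB : ∀ j : Fin 3, HasScaleBound (∂_{e j} ζ) ρ B)
    (hA' : HasScaleBound a ρ' A') (hB' : ∀ j : Fin 3, HasScaleBound (∂_{e j} a) ρ' B')
    {i j : Fin 3} (hi : ∀ ξ : R3, |ξ i| ≤ hnorm ξ) (hj : ∀ ξ : R3, |ξ j| ≤ hnorm ξ)
    (hS : ∀ u, ‖S (op (blockSymbol φ k l) u)‖ₑ ≤
      ‖a (op (divH i (blockSymbol φ k l)) u)‖ₑ + ‖ζ (op (divH j (blockSymbol φ k l)) u)‖ₑ) :
    lpNorm 2 (blockH φ k (blockV φ l S)) ≤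
      8 * M * (2 : ℝ≥0∞) ^ (-k : ℝ) * (ρ k l * gain A B k l + ρ' k l * gain A' B' k l) := by
  refine lpNorm_two_le _ _ fun u => ?_
  rw [hφ.block_apply]
  set N := eLpNorm (⇑u) 2 volume
  have h1 := hA.gain hB (hn.divH hj) u
  have h2 := hA'.gain hB' (hn.divH hi) u
  have hc := coe_div_bound_le k M
  calc ‖S (op (blockSymbol φ k l) u)‖ₑ
      ≤ gain A' B' k l * (4 * ρ' k l * (2 * (2 : ℝ≥0∞) ^ (-k : ℝ) * M) * N) +
        gain A B k l * (4 * ρ k l * (2 * (2 : ℝ≥0∞) ^ (-k : ℝ) * M) * N) := by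
        refine (hS u).trans (add_le_add (h2.trans ?_) (h1.trans ?_)) <;> gcongr
    _ = _ := by ring

theorem besovNorm_two_one_one (φ : ℝ → ℝ) (s : ℝ) (S : 𝓢'(R3, ℂ)) :
    besovNorm φ 2 1 1 s 1 S =
      ∑' k : ℤ, ∑' l : ℤ, (2 : ℝ≥0∞) ^ (k + l * s : ℝ) * lpNorm 2 (blockH φ k (blockV φ l S)) := by
  rw [besovNorm]
  simp only [one_mul, mul_one, ENNReal.rpow_one, div_one, ← ENNReal.tsum_mul_left]
  refine tsum_congr fun k => tsum_congr fun l => ?_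
  rw [← mul_assoc, ← two_rpow_add]

end AnisoBesov

open AnisoBesov

theorem proposition4p1 (φ : ℝ → ℝ) (hφ : AnisoBesov.IsDyadicCutoff φ)
    (α θ : ℝ) (hα : α ∈ Set.Ioo (0 : ℝ) (1 / 2)) (hθ : θ ∈ Set.Ioo (0 : ℝ) (1 / 2)) :
    ∃ C : ℝ≥0, ∀ (v : Fin 3 → 𝓢'(AnisoBesov.R3, ℂ)) (w : AnisoBesov.R3 → ℝ),
      AnisoBesov.DivergenceFree v →
      AnisoBesov.IsGivenBy (AnisoBesov.vorticity v) (fun x => (w x : ℂ)) →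
      AnisoBesov.besovNorm φ 2 1 1 (1 / 2 - α) 1 (v 0) +
          AnisoBesov.besovNorm φ 2 1 1 (1 / 2 - α) 1 (v 1) ≤
        C * (eLpNorm (fun x => AnisoBesov.signedPow (3 / 4) (w x)) 2 volume ^ (1 / 3 + α) *
              AnisoBesov.gradLpNorm 2 (fun x => AnisoBesov.signedPow (3 / 4) (w x)) ^ (1 - α) +
            AnisoBesov.hThetaNorm θ (∂_{AnisoBesov.e 2} (v 2)) ^ α *
              AnisoBesov.gradHThetaNorm θ (∂_{AnisoBesov.e 2} (v 2)) ^ (1 - α)) := by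
  obtain ⟨hα0, hα1⟩ := hα
  obtain ⟨hθ0, hθ1⟩ := id hθ
  obtain ⟨M, hM⟩ := hφ.isLocalized_blockSymbol
  obtain ⟨K, hK⟩ := exists_tsum_gain_le (p := 1 / 3) (q := 2 / 3 - α) (by norm_num) (by linarith)
    (by linarith)
  obtain ⟨K', hK'⟩ := exists_tsum_gain_le (p := 1 / 2 - θ) (q := 1 / 2 - α + θ) (by linarith)
    (by linarith) (by linarith)
  refine ⟨2 * (8 * M * (12 * K + 2 * K')), fun v w hdiv hw => ?_⟩
  set X := eLpNorm (fun x => signedPow (3 / 4) (w x)) 2 volume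
  set Y := gradLpNorm 2 (fun x => signedPow (3 / 4) (w x))
  set A' := hThetaNorm θ (∂_{e 2} (v 2))
  set B' := gradHThetaNorm θ (∂_{e 2} (v 2))
  set A := X ^ (4 / 3 : ℝ) with hAdef
  set B := 2 * (X ^ (1 / 3 : ℝ) * Y) with hBdef
  have hA : HasScaleBound (vorticity v) bernsteinWeight A :=
    hasScaleBound_of_enorm_le hw.enorm_apply_le
  have hB : ∀ j, HasScaleBound (∂_{e j} (vorticity v)) bernsteinWeight B := fun j =>
    hasScaleBound_of_enorm_le (hw.enorm_lineDeriv_apply_le j)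
  have hA' : HasScaleBound (∂_{e 2} (v 2)) (thetaWeight θ) A' := hasScaleBound_hThetaNorm hθ _
  have hB' : ∀ j, HasScaleBound (∂_{e j} (∂_{e 2} (v 2))) (thetaWeight θ) B' := fun j =>
    (hasScaleBound_hThetaNorm hθ _).mono (hThetaNorm_lineDeriv_le θ _ j)
  have hAB : A ^ (1 - (1 / 3 + (2 / 3 - α))) * B ^ (1 / 3 + (2 / 3 - α)) ≤
      2 * (X ^ (1 / 3 + α) * Y ^ (1 - α)) := by
    have h2 : (2 : ℝ≥0∞) ^ (1 - α) ≤ 2 := by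
      simpa using two_rpow_le (show 1 - α ≤ 1 by linarith)
    rw [show 1 - (1 / 3 + (2 / 3 - α)) = α by ring, show 1 / 3 + (2 / 3 - α) = 1 - α by ring, hAdef,
      hBdef, ENNReal.mul_rpow_of_nonneg _ _ (by linarith),
      ENNReal.mul_rpow_of_nonneg _ _ (by linarith), ← ENNReal.rpow_mul, ← ENNReal.rpow_mul,
      show 1 / 3 + α = 4 / 3 * α + 1 / 3 * (1 - α) by ring,
      ENNReal.rpow_add_of_nonneg _ _ (by linarith) (by linarith)]
    calc X ^ (4 / 3 * α) * (2 ^ (1 - α) * (X ^ (1 / 3 * (1 - α)) * Y ^ (1 - α)))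
        = 2 ^ (1 - α) * (X ^ (4 / 3 * α) * X ^ (1 / 3 * (1 - α)) * Y ^ (1 - α)) := by ring
      _ ≤ _ := by gcongr
  have hmain : ∀ S : 𝓢'(R3, ℂ), (∀ k l : ℤ, lpNorm 2 (blockH φ k (blockV φ l S)) ≤
      8 * M * (2 : ℝ≥0∞) ^ (-k : ℝ) *
        (bernsteinWeight k l * gain A B k l + thetaWeight θ k l * gain A' B' k l)) →
      besovNorm φ 2 1 1 (1 / 2 - α) 1 S ≤
        8 * M * (12 * K + 2 * K') * (X ^ (1 / 3 + α) * Y ^ (1 - α) + A' ^ α * B' ^ (1 - α)) := by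
    intro S hS
    rw [besovNorm_two_one_one]
    calc ∑' k : ℤ, ∑' l : ℤ, (2 : ℝ≥0∞) ^ (k + l * (1 / 2 - α) : ℝ) *
          lpNorm 2 (blockH φ k (blockV φ l S))
        ≤ ∑' k : ℤ, ∑' l : ℤ, (8 * M * 6 * (2 ^ (k * (1 / 3) + l * (2 / 3 - α) : ℝ) * gain A B k l)
          + 8 * M * 2 * (2 ^ (k * (1 / 2 - θ) + l * (1 / 2 - α + θ) : ℝ) * gain A' B' k l)) := by
          refine ENNReal.tsum_le_tsum fun k => ENNReal.tsum_le_tsum fun l => ?_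
          refine (mul_le_mul_right (hS k l) _).trans (le_of_eq ?_)
          have e1 : (2 : ℝ≥0∞) ^ (k * (1 / 3) + l * (2 / 3 - α) : ℝ) =
              2 ^ (k + l * (1 / 2 - α) : ℝ) * 2 ^ (-k : ℝ) * 2 ^ (k / 3 + l / 6 : ℝ) := by
            rw [← two_rpow_add, ← two_rpow_add]
            congr 1
            ring
          have e2 : (2 : ℝ≥0∞) ^ (k * (1 / 2 - θ) + l * (1 / 2 - α + θ) : ℝ) =
              2 ^ (k + l * (1 / 2 - α) : ℝ) * 2 ^ (-k : ℝ) *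
                2 ^ (k * (1 / 2 - θ) + l * θ : ℝ) := by
            rw [← two_rpow_add, ← two_rpow_add]
            congr 1
            ring
          rw [e1, e2, bernsteinWeight, thetaWeight]
          ring
      _ = 8 * M * 6 * (∑' k : ℤ, ∑' l : ℤ,
            2 ^ (k * (1 / 3) + l * (2 / 3 - α) : ℝ) * gain A B k l) +
          8 * M * 2 * ∑' k : ℤ, ∑' l : ℤ,
            2 ^ (k * (1 / 2 - θ) + l * (1 / 2 - α + θ) : ℝ) * gain A' B' k l := by
          simp_rw [ENNReal.tsum_add, ENNReal.tsum_mul_left]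
      _ ≤ 8 * M * 6 * (K * (2 * (X ^ (1 / 3 + α) * Y ^ (1 - α)))) +
          8 * M * 2 * (K' * (A' ^ α * B' ^ (1 - α))) := by
          have h2 := hK' A' B'
          rw [show 1 - (1 / 2 - θ + (1 / 2 - α + θ)) = α by ring,
            show 1 / 2 - θ + (1 / 2 - α + θ) = 1 - α by ring] at h2
          refine add_le_add (mul_le_mul_right ((hK A B).trans ?_) _) (mul_le_mul_right h2 _)
          gcongr
      _ ≤ 8 * M * 6 * (K * (2 * (X ^ (1 / 3 + α) * Y ^ (1 - α)))) +
          8 * M * 2 * (K' * (A' ^ α * B' ^ (1 - α))) +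
          (8 * M * (2 * K') * (X ^ (1 / 3 + α) * Y ^ (1 - α)) +
            8 * M * (12 * K) * (A' ^ α * B' ^ (1 - α))) := le_self_add
      _ = _ := by ring
  have hI : ∀ z₁ z₂ : ℂ, ‖-(2 * Real.pi * Complex.I : ℂ)⁻¹ * (z₁ + z₂)‖ₑ ≤ ‖z₁‖ₑ + ‖z₂‖ₑ := by
    intro z₁ z₂
    rw [enorm_mul, enorm_neg]
    calc _ ≤ 1 * (‖z₁‖ₑ + ‖z₂‖ₑ) := mul_le_mul' enorm_two_pi_I_inv_le (enorm_add_le _ _)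
      _ = _ := one_mul _
  have h0 := hmain (v 0) fun k l => lpNorm_block_le hφ (hM k l) hA hB hA' hB'
    abs_zero_le_hnorm abs_one_le_hnorm fun u => by
      rw [biotSavart_zero (hM k l) hdiv]
      exact hI _ _
  have h1 := hmain (v 1) fun k l => lpNorm_block_le hφ (hM k l) hA hB hA' hB'
    abs_one_le_hnorm abs_zero_le_hnorm fun u => by
      rw [biotSavart_one (hM k l) hdiv, sub_eq_add_neg]
      exact (hI _ _).trans (by rw [enorm_neg])
  refine (add_le_add h0 h1).trans (le_of_eq ?_)
  push_cast
  ring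

end
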